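/- Setting. There are $N$ arms and one player, who plays one arm at each time $t=1,2,\dots$. Playing arm $n$ at time $t$ yields $X_n(t)$, where $X_n(1),X_n(2),\dots$ are i.i.d. with law $f_n$ and finite mean $\theta_n$. Let $\sigma$ be a permutation of $\{1,\dots,N\}$ with $\theta_{\sigma(1)}\ge\dots\ge\theta_{\sigma(N)}$ and $\Delta_j=\theta_{\sigma(1)}-\theta_{\sigma(j)}$. Fix $1\le M<N$ with $\Delta_{M+1}-\Delta_M>0$. The target is the set of the $M$ best arms: each play of the $j$-th best arm $\sigma(j)$, $j>M$, costs $C_j>0$, and playing one of the arms $\sigma(1),\dots,\sigma(M)$ costs nothing. Let $C_{\max}=\max_{j>M}C_j$, and let the regret $R_T$ be the expected total cost of the plays at times $1,\dots,T$. DSEE policy with threshold $g$. Let $\mathcal A(1)=\emptyset$, and for $t>1$ let $\mathcal A(t)=\mathcal A(t-1)\cup\{t\}$ if $|\mathcal A(t-1)|<g(t)$ and $\mathcal A(t)=\mathcal A(t-1)$ otherwise. At a time $t\in\mathcal A(t)$ play arm $((|\mathcal A(t)|-1)\bmod N)+1$. At a time $t\notin\mathcal A(t)$ play one of the $M$ arms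 with the largest sample means (in (4): truncated sample means), computed from the observations at the times in $\mathcal A(t-1)$; the choice among these arms and the resolution of ties are arbitrary, and any arm may be played while some arm has not been observed yet. Theorem. (1) Let $a,\zeta,u_0>0$ be such that, for every arm, either the moment-generating function of $f_n$ is finite on $[-u_0,u_0]$, that of $X_n(1)-\theta_n$ has second derivative at most $\zeta$ on $(-u_0,u_0)$, and $a\le 1/(2\zeta)$; or, more generally, $\Pr\big(\big|\frac1s\sum_{t=1}^sX_n(t)-\theta_n\big|\ge\delta'\big)\le 2e^{-a\delta'^2s}$ for all integers $s\ge1$ and all $\delta'\in[0,\zeta u_0]$ (the same alternative for all arms). Let $0<c<\Delta_{M+1}-\Delta_M$, $\delta=\min\{c/2,\zeta u_0\}$, $w>\frac1{a\delta^2}$ and $g(t)=N\lceil w\log t\rceil$. Then for all $T\ge1$ $$R_T\le\sum_{j=M+1}^N\lceil w\log T\rceil\,C_j+2N\,C_{\max}\Big(1+\frac1{a\delta^2w-1}\Big).$$ (2) Let all $f_n$ be light-tailed (the moment-generating function is finite in a neighbourhood of $0$), let $f(t)$ be a positive nondecreasing sequence with $f(t)\to\infty$, and let $g(t)=N\lceil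 f(t)\log t\rceil$. Then $R_T=O(f(T)\log T)$. (3) Let $p>1$, let all $f_n$ have a finite $p$-th absolute moment, let $v>0$, and let $g(t)=vt^{1/p}$ if $p\le2$ and $g(t)=vt^{1/(1+p/2)}$ if $p>2$. Then $R_T=O(T^{1/p})$ if $p\le 2$ and $R_T=O(T^{1/(1+p/2)})$ if $p>2$. (4) Let $1<p\le2$ and $u>0$ with $\mathbb E|X_n(1)|^p\le u$ for all $n$. Let $a=4^{p/(1-p)}u^{1/(1-p)}$, $0<\delta<\frac12(\Delta_{M+1}-\Delta_M)$, $w>\frac{1}{a\delta^{p/(p-1)}}$ and $g(t)=N\lceil w\log t\rceil$. At exploitation times use the truncated sample means $$\widehat\theta_n(t)=\frac1{\tau_n}\sum_{k=1}^{\tau_n}X_{n,k}\,\mathbf 1\Big\{|X_{n,k}|\le\Big(\frac{uk}{\log(\epsilon_n^{-1})}\Big)^{1/p}\Big\},\qquad \epsilon_n=\exp(-a\delta^{p/(p-1)}\tau_n),$$ where $X_{n,k}$ is the $k$-th observation of arm $n$ in the exploration sequence and $\tau_n=\tau_n(t)$ the number of such observations before time $t$. Then for all $T\ge1$ $$R_T\le\sum_{j=M+1}^N\lceil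 w\log T\rceil\,C_j+2N\,C_{\max}\Big(1+\frac1{a\delta^{p/(p-1)}w-1}\Big).$$ The constants in the $O(\cdot)$ of (2) and (3) do not depend on how the arm among the $M$ ones with the largest sample means is selected. -/

import Mathlib

open MeasureTheory ProbabilityTheory Filter

universe u

namespace DSEE

noncomputable section

/-! ### Arms, ranks and costs

Arms are `Fin N`; the reward of arm `n` has law `F n`.  A permutation `σ` sorts the arms by mean, so
rank `j : Fin N` (zero-based: `j = 0` is the best rank) is held by arm `σ j`. -/

/-- The mean of a reward distribution. -/
def mean (D : Measure ℝ) : ℝ := ∫ x, x ∂D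

/-- `σ` lists the arms by nonincreasing mean. -/
def SortsArms {N : ℕ} (F : Fin N → Measure ℝ) (σ : Equiv.Perm (Fin N)) : Prop :=
  ∀ i j : Fin N, i ≤ j → mean (F (σ j)) ≤ mean (F (σ i))

/-- Difference between the largest mean and the mean of the arm of (zero-based) rank `j`. -/
def delta {N : ℕ} (F : Fin N → Measure ℝ) (σ : Equiv.Perm (Fin N)) (j : Fin N) : ℝ :=
  mean (F (σ ⟨0, j.pos⟩)) - mean (F (σ j))

/-- Gap between the `M`-th and the `(M+1)`-th best arm (zero-based ranks `M - 1` and `M`). -/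
def gap {N : ℕ} (F : Fin N → Measure ℝ) (σ : Equiv.Perm (Fin N)) (M : ℕ) (hMN : M < N) : ℝ :=
  delta F σ ⟨M, hMN⟩ - delta F σ ⟨M - 1, lt_of_le_of_lt (Nat.sub_le M 1) hMN⟩

/-- Cost of one play of the arm of rank `j`: nothing for the `M` best arms, `C j` for the others. -/
def setCost {N : ℕ} (M : ℕ) (C : Fin N → ℝ) (j : Fin N) : ℝ :=
  if (j : ℕ) < M then 0 else C j

/-- The largest cost of a single play. -/
def maxCost {N : ℕ} (M : ℕ) (C : Fin N → ℝ) : ℝ := ⨆ j : Fin N, setCost M C j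

/-! ### Tail conditions on a reward distribution -/

/-- The moment generating function is finite in a neighbourhood of `0`. -/
def LightTailed (D : Measure ℝ) : Prop :=
  ∃ u₀ : ℝ, 0 < u₀ ∧ ∀ u : ℝ, |u| ≤ u₀ → Integrable (fun x : ℝ => Real.exp (u * x)) D

/-- The moment generating function is finite on `[-u₀, u₀]`, and `ζ` bounds from above the second
derivative of the moment generating function of the centred reward. (The second derivative is
asked for at interior points, where it always exists.) -/
def LightTailedWith (D : Measure ℝ) (ζ u₀ : ℝ) : Prop :=
  (∀ u : ℝ, |u| ≤ u₀ → Integrable (fun x : ℝ => Real.exp (u * x)) D) ∧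
  ∀ u : ℝ, |u| < u₀ → iteratedDeriv 2 (mgf (fun x : ℝ => x - mean D) D) u ≤ ζ

/-- The Chernoff-Hoeffding inequality with constants `a, ζ, u₀` for the mean of `s` independent
samples of `D`. -/
def ChernoffHolds (D : Measure ℝ) (a ζ u₀ : ℝ) : Prop :=
  ∀ δ : ℝ, 0 ≤ δ → δ ≤ ζ * u₀ → ∀ s : ℕ, 1 ≤ s →
    (Measure.pi (fun _ : Fin s => D)).real {x | δ ≤ |(∑ i, x i) / (s : ℝ) - mean D|}
      ≤ 2 * Real.exp (-(a * δ ^ 2 * (s : ℝ)))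

/-! ### Deterministic sequencing of exploration and exploitation -/

/-- `exploreSet g t` is the set of exploration times up to and including `t` (time starts at `1`):
a time `t > 1` is an exploration time iff fewer than `g t` times have been so before. -/
def exploreSet (g : ℕ → ℝ) : ℕ → Finset ℕ
  | 0 => ∅
  | t + 1 =>
    if 1 < t + 1 ∧ ((exploreSet g t).card : ℝ) < g (t + 1) then insert (t + 1) (exploreSet g t)
    else exploreSet g t

/-- Zero-based index of the arm that is played at an exploration time `t` (round-robin). -/
def roundRobin (g : ℕ → ℝ) (N t : ℕ) : ℕ := ((exploreSet g t).card - 1) % N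

/-- The exploration times up to and including `t` at which arm `n` is played. -/
def obsTimes {N : ℕ} (g : ℕ → ℝ) (n : Fin N) (t : ℕ) : Finset ℕ :=
  (exploreSet g t).filter fun s => roundRobin g N s = (n : ℕ)

/-- The number of exploration observations of arm `n` up to and including time `t`. -/
def obsCount {N : ℕ} (g : ℕ → ℝ) (n : Fin N) (t : ℕ) : ℕ := (obsTimes g n t).card

/-- Sample mean of arm `n` at time `t`, from the exploration observations before time `t`;
`x n s` is the reward of arm `n` at time `s`. -/
def sampleMean {N : ℕ} (g : ℕ → ℝ) (x : Fin N → ℕ → ℝ) (n : Fin N) (t : ℕ) : ℝ :=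
  (∑ s ∈ obsTimes g n (t - 1), x n s) / (obsCount g n (t - 1) : ℝ)

/-- The truncation level `ε` of arm `n` at time `t`: `exp (-b τ)`, where `τ` is the number of
exploration observations before time `t`. -/
def truncEps {N : ℕ} (g : ℕ → ℝ) (b : ℝ) (n : Fin N) (t : ℕ) : ℝ :=
  Real.exp (-(b * (obsCount g n (t - 1) : ℝ)))

/-- Truncated sample mean of arm `n` at time `t`: the `k`-th exploration observation counts only if
its modulus is at most `(u k / log (1 / ε)) ^ (1 / p)`.  The observation made at time `s` is the
one of number `k = obsCount g n s`. -/
def truncMean {N : ℕ} (p u b : ℝ) (g : ℕ → ℝ) (x : Fin N → ℕ → ℝ) (n : Fin N) (t : ℕ) : ℝ :=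
  (∑ s ∈ obsTimes g n (t - 1),
    if |x n s| ≤ (u * (obsCount g n s : ℝ) / Real.log (truncEps g b n t)⁻¹) ^ (1 / p)
    then x n s else 0) / (obsCount g n (t - 1) : ℝ)

/-- The rewards `X n t` of each arm `n` are i.i.d. over time with law `F n`. -/
structure IsRewardModel {N : ℕ} {Ω : Type*} [MeasurableSpace Ω] (F : Fin N → Measure ℝ)
    (μ : Measure Ω) (X : Fin N → ℕ → Ω → ℝ) : Prop where
  measurable : ∀ n t, Measurable (X n t)
  law : ∀ n t, μ.map (X n t) = F n
  indep : ∀ n, iIndepFun (fun t => X n t) μ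

/-- The plays follow the DSEE approach with exploration threshold `g` and mean estimator `est` for
the target "the `M` best arms": round-robin at exploration times, and at exploitation times one of
the `M` arms with the largest estimates, that is, an arm such that fewer than `M` arms have a
strictly larger estimate (ties, and the choice among the `M` arms, are resolved in any way, and the
choice is free while some arm has no observation yet, so that its estimate is undefined).
In particular this covers every policy that maps the history to an arm subject to these rules. -/
structure FollowsDSEE {N : ℕ} {Ω : Type*} [MeasurableSpace Ω] (M : ℕ) (g : ℕ → ℝ)
    (est : (Fin N → ℕ → ℝ) → Fin N → ℕ → ℝ) (X : Fin N → ℕ → Ω → ℝ)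
    (play : ℕ → Ω → Fin N) : Prop where
  measurable : ∀ t, Measurable (play t)
  explore : ∀ t ω, t ∈ exploreSet g t → (play t ω : ℕ) = roundRobin g N t
  exploit : ∀ t ω, 1 ≤ t → t ∉ exploreSet g t → (∀ n : Fin N, 0 < obsCount g n (t - 1)) →
    (Finset.univ.filter fun m : Fin N =>
      est (fun n s => X n s ω) (play t ω) t < est (fun n s => X n s ω) m t).card < M

/-- Regret for the target "the `M` best arms": the expected total cost of the plays at `1, …, T`. -/
def regret {N : ℕ} {Ω : Type*} [MeasurableSpace Ω] (σ : Equiv.Perm (Fin N)) (M : ℕ)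
    (C : Fin N → ℝ) (μ : Measure Ω) (play : ℕ → Ω → Fin N) (T : ℕ) : ℝ :=
  ∫ ω, ∑ t ∈ Finset.Icc 1 T, setCost M C (σ.symm (play t ω)) ∂μ

/-- For all times `T ≥ T₀`, the regret is at most `B T` for DSEE with exploration threshold `g` and
estimator `est`, on every probability space that carries rewards with laws `F`, and however the
arm among the `M` ones with the largest estimates is selected. -/
def RegretAtMost {N : ℕ} (F : Fin N → Measure ℝ) (σ : Equiv.Perm (Fin N)) (M : ℕ)
    (C : Fin N → ℝ) (g : ℕ → ℝ) (est : (Fin N → ℕ → ℝ) → Fin N → ℕ → ℝ)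
    (T₀ : ℕ) (B : ℕ → ℝ) : Prop :=
  ∀ (Ω : Type u) [MeasurableSpace Ω] (μ : Measure Ω) [IsProbabilityMeasure μ]
    (X : Fin N → ℕ → Ω → ℝ) (play : ℕ → Ω → Fin N),
    IsRewardModel F μ X → FollowsDSEE M g est X play →
    ∀ T : ℕ, T₀ ≤ T → regret σ M C μ play T ≤ B T

end

end DSEE

/-!
The exploration times, and hence the number of observations behind every estimate, are
deterministic. So the regret splits (`regret_le`) into an exploration cost, which is read off from
the number of observations of each arm by time `T`, and the sum over the exploitation times of the
probability of playing an arm outside the `M` best ones. Such a play requires an estimate that is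
off by at least `δ`, for any `δ` up to half of the gap (`rank_lt_of_estimates_close`), so by a union
bound over the arms only deviation probabilities of the estimates matter. Since the random
selection rule enters only through this inclusion of events, the bounds hold for every selection.

* With the threshold `N ⌈w log t⌉`, an exploitation at time `t > 1` uses at least `w log t`
  observations of each arm. A deviation probability `2 exp (-b τ)` after `τ` observations becomes
  `2 t ^ (-b w)`, which is summable as `b w > 1` (`regret_le_of_exp_deviation`). For light tails the
  rate comes from Chernoff's bound (`sampleMean_deviation_le_of_lightTailedWith`), for moments of
  order `p ≤ 2` from Chernoff's bound for truncated variables (`truncMean_deviation_le`).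
* If the tails are light with unknown constants, a diverging factor `f` eventually exceeds
  `2 / b` for the unknown rate `b`, and only finitely many times remain
  (`exists_regretAtMost_of_lightTailed`).
* With a finite moment of order `p`, truncation at a level proportional to the sample size `s` gives
  a deviation probability `O(s ^ (1 - p))` (`exists_polynomial_deviation_bound`). For any exponent
  `e ∈ [1 / p, 1]` this balances the exploration cost `O(T ^ e)`
  (`exists_regretAtMost_of_moment`). When `p > 2` it is stronger than the order `s ^ (-p / 2)` that
  the exponent `1 / (1 + p / 2)` calls for.

Both truncation arguments rest on `mgf_trunc_le`, which bounds the moment generating function of a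
truncated variable around the untruncated mean, bias included.
-/

namespace DSEE

noncomputable section

/-! ### The exploration sequence -/

theorem one_lt_and_le_of_mem_exploreSet {g : ℕ → ℝ} {s t : ℕ} (h : s ∈ exploreSet g t) :
    1 < s ∧ s ≤ t := by
  induction t with
  | zero => simp [exploreSet] at h
  | succ t ih =>
    rw [exploreSet] at h
    split_ifs at h with hc
    · rcases Finset.mem_insert.1 h with rfl | h
      · exact ⟨hc.1, le_rfl⟩
      · exact ⟨(ih h).1, (ih h).2.trans t.le_succ⟩
    · exact ⟨(ih h).1, (ih h).2.trans t.le_succ⟩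

theorem succ_notMem_exploreSet (g : ℕ → ℝ) (t : ℕ) : t + 1 ∉ exploreSet g t := fun h =>
  absurd (one_lt_and_le_of_mem_exploreSet h).2 (by simp)

theorem exploreSet_mono (g : ℕ → ℝ) : Monotone (exploreSet g) := by
  refine monotone_nat_of_le_succ fun t => ?_
  rw [exploreSet.eq_2]
  split_ifs
  · exact Finset.subset_insert _ _
  · exact le_rfl

theorem mem_exploreSet_iff {g : ℕ → ℝ} {s t : ℕ} (hst : s ≤ t) :
    s ∈ exploreSet g t ↔ s ∈ exploreSet g s := by
  induction t, hst using Nat.le_induction with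
  | base => rfl
  | succ t hst ih =>
    rw [← ih, exploreSet.eq_2]
    split_ifs
    · rw [Finset.mem_insert, or_iff_right (by omega)]
    · rfl

/-- At an exploitation time the exploration has reached its threshold. -/
theorem le_card_exploreSet {g : ℕ → ℝ} {t : ℕ} (ht : 1 < t) (h : t ∉ exploreSet g t) :
    g t ≤ ((exploreSet g (t - 1)).card : ℝ) := by
  obtain ⟨k, rfl⟩ : ∃ k, t = k + 1 := ⟨t - 1, by omega⟩
  rw [exploreSet] at h
  split_ifs at h with hc
  · simp at h
  · simpa [ht] using hc

theorem card_exploreSet_le {g : ℕ → ℝ} (hg : Monotone g) (h0 : ∀ t, 0 ≤ g t) (t : ℕ) :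
    ((exploreSet g t).card : ℝ) ≤ g t + 1 := by
  induction t with
  | zero => simpa [exploreSet] using by linarith [h0 0]
  | succ t ih =>
    have hm := hg t.le_succ
    rw [exploreSet]
    split_ifs with hc
    · rw [Finset.card_insert_of_notMem (succ_notMem_exploreSet g t)]
      push_cast
      linarith [hc.2]
    · exact ih.trans (by simpa using hm)

/-- An integral threshold is never exceeded. -/
theorem card_exploreSet_le_of_nat {g : ℕ → ℝ} {m : ℕ → ℕ} (hg : ∀ t, g t = m t)
    (hm : Monotone m) (t : ℕ) : (exploreSet g t).card ≤ m t := by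
  induction t with
  | zero => simp [exploreSet]
  | succ t ih =>
    rw [exploreSet]
    split_ifs with hc
    · rw [Finset.card_insert_of_notMem (succ_notMem_exploreSet g t)]
      have := hc.2
      rw [hg] at this
      exact_mod_cast this
    · exact ih.trans (hm t.le_succ)

/-- The number of observations of arm `n` counts the integers below the number of exploration
times that are congruent to `n`. -/
theorem obsCount_eq_count {N : ℕ} (g : ℕ → ℝ) (n : Fin N) (t : ℕ) :
    obsCount g n t = Nat.count (fun i => i ≡ n [MOD N]) (exploreSet g t).card := by
  induction t with
  | zero => simp [obsCount, obsTimes, exploreSet]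
  | succ t ih =>
    by_cases hc : 1 < t + 1 ∧ ((exploreSet g t).card : ℝ) < g (t + 1)
    · have he : exploreSet g (t + 1) = insert (t + 1) (exploreSet g t) := by
        rw [exploreSet, if_pos hc]
      have hr : roundRobin g N (t + 1) = (exploreSet g t).card % N := by
        rw [roundRobin, he, Finset.card_insert_of_notMem (succ_notMem_exploreSet g t)]
        simp
      have hn : (exploreSet g t).card ≡ n [MOD N] ↔ roundRobin g N (t + 1) = n := by
        rw [hr, Nat.ModEq, Nat.mod_eq_of_lt n.isLt]
      rw [he, Finset.card_insert_of_notMem (succ_notMem_exploreSet g t), Nat.count_succ, ← ih,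
        obsCount, obsTimes, he, Finset.filter_insert]
      simp only [hn]
      split_ifs with hi
      · rw [Finset.card_insert_of_notMem (by simp [succ_notMem_exploreSet])]
        rfl
      · rfl
    · have he : exploreSet g (t + 1) = exploreSet g t := by rw [exploreSet, if_neg hc]
      rw [he, ← ih, obsCount, obsTimes, he]
      rfl

theorem le_obsCount {N : ℕ} {g : ℕ → ℝ} {t m : ℕ} (n : Fin N)
    (h : N * m ≤ (exploreSet g t).card) : m ≤ obsCount g n t := by
  have hN : 0 < N := n.pos
  rw [obsCount_eq_count, Nat.count_modEq_card _ hN]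
  exact ((Nat.le_div_iff_mul_le hN).2 (by rwa [mul_comm])).trans (Nat.le_add_right _ _)

theorem obsCount_le {N : ℕ} {g : ℕ → ℝ} {t m : ℕ} (n : Fin N)
    (h : (exploreSet g t).card ≤ N * m) : obsCount g n t ≤ m := by
  have hN : 0 < N := n.pos
  rw [obsCount_eq_count]
  refine (Nat.count_monotone _ h).trans ?_
  rw [Nat.count_modEq_card _ hN]
  simp [Nat.mul_div_cancel_left _ hN]

theorem card_exploreSet_le_mul_obsCount {N : ℕ} (g : ℕ → ℝ) (t : ℕ) (n : Fin N) :
    (exploreSet g t).card ≤ N * (obsCount g n t + 1) := by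
  have hN : 0 < N := n.pos
  have h := le_obsCount (g := g) (t := t) n (Nat.mul_div_le _ N)
  have := Nat.lt_mul_div_succ (exploreSet g t).card hN
  exact this.le.trans (Nat.mul_le_mul_left _ (by omega))

theorem obsTimes_succ {N : ℕ} (g : ℕ → ℝ) (n : Fin N) (t : ℕ) :
    (obsTimes g n (t + 1) = obsTimes g n t) ∨
      (t + 1 ∉ obsTimes g n t ∧ obsTimes g n (t + 1) = insert (t + 1) (obsTimes g n t)) := by
  have hnot : t + 1 ∉ obsTimes g n t := by simp [obsTimes, succ_notMem_exploreSet]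
  rw [obsTimes, obsTimes, exploreSet]
  split_ifs
  · rw [Finset.filter_insert]
    split_ifs
    · exact Or.inr ⟨hnot, rfl⟩
    · exact Or.inl rfl
  · exact Or.inl rfl

/-- The exploration observations of an arm are numbered consecutively by `obsCount`. -/
theorem sum_obsTimes_eq {N : ℕ} (g : ℕ → ℝ) (n : Fin N) (φ : ℕ → ℝ) (t : ℕ) :
    ∑ s ∈ obsTimes g n t, φ (obsCount g n s) = ∑ k ∈ Finset.Icc 1 (obsCount g n t), φ k := by
  induction t with
  | zero => simp [obsCount, obsTimes, exploreSet]
  | succ t ih =>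
    rcases obsTimes_succ g n t with h | ⟨hn, h⟩
    · rw [obsCount, h, ih, obsCount]
    · have hc : obsCount g n (t + 1) = obsCount g n t + 1 := by
        rw [obsCount, h, Finset.card_insert_of_notMem hn, obsCount]
      rw [h, Finset.sum_insert hn, ih, hc, Finset.sum_Icc_succ_top (by omega)]
      ring

theorem obsTimes_mono {N : ℕ} (g : ℕ → ℝ) (n : Fin N) : Monotone (obsTimes g n) :=
  fun _ _ h => Finset.filter_subset_filter _ (exploreSet_mono g h)

theorem obsCount_mono {N : ℕ} (g : ℕ → ℝ) (n : Fin N) : Monotone (obsCount g n) :=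
  fun _ _ h => Finset.card_le_card (obsTimes_mono g n h)

theorem obsCount_pos_of_mem {N : ℕ} {g : ℕ → ℝ} {n : Fin N} {s t : ℕ} (h : s ∈ obsTimes g n t) :
    0 < obsCount g n s := by
  refine Finset.card_pos.2 ⟨s, ?_⟩
  rw [obsTimes, Finset.mem_filter] at h ⊢
  exact ⟨(mem_exploreSet_iff (one_lt_and_le_of_mem_exploreSet h.1).2).1 h.1, h.2⟩

theorem le_of_mem_obsTimes {N : ℕ} {g : ℕ → ℝ} {n : Fin N} {s t : ℕ} (h : s ∈ obsTimes g n t) :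
    s ≤ t :=
  (one_lt_and_le_of_mem_exploreSet (Finset.mem_filter.1 h).1).2

/-! ### Sums of powers -/

/-- Bernoulli's inequality makes `k ↦ k ^ e / e` a telescoping majorant. -/
theorem sum_Icc_rpow_sub_one_le {e : ℝ} (he : 0 < e) (he1 : e ≤ 1) (T : ℕ) :
    ∑ t ∈ Finset.Icc 1 T, (t : ℝ) ^ (e - 1) ≤ (T : ℝ) ^ e / e := by
  induction T with
  | zero => simp [he.ne']
  | succ T ih =>
    rw [Finset.sum_Icc_succ_top (by omega)]
    refine (add_le_add_left ih _).trans ?_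
    have hT : (0 : ℝ) < T + 1 := by positivity
    have hb := rpow_one_add_le_one_add_mul_self (s := -1 / ((T : ℝ) + 1))
      (by rw [le_div_iff₀ hT]; linarith [T.cast_nonneg (α := ℝ)]) he.le he1
    have h1 : (1 : ℝ) + -1 / (T + 1) = T / (T + 1) := by field_simp; ring
    rw [h1, Real.div_rpow (by positivity) hT.le, div_le_iff₀ (by positivity)] at hb
    push_cast
    rw [Real.rpow_sub_one hT.ne', le_div_iff₀ he, add_mul, div_mul_cancel₀ _ he.ne']
    calc _ ≤ (1 + e * (-1 / ((T : ℝ) + 1))) * ((T : ℝ) + 1) ^ e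
          + ((T : ℝ) + 1) ^ e / (T + 1) * e := by gcongr
      _ = _ := by field_simp; ring

/-- Telescoping with the majorant `-k ^ (1 - α) / (α - 1)`. -/
theorem sum_Icc_two_rpow_neg_le {α : ℝ} (hα : 1 < α) (T : ℕ) :
    ∑ t ∈ Finset.Icc 2 T, (t : ℝ) ^ (-α) ≤ 1 / (α - 1) := by
  have h0 : 0 < α - 1 := by linarith
  rcases Nat.lt_or_ge T 1 with h | h
  · rw [Finset.Icc_eq_empty (by omega)]; simpa using h0.le
  have key : ∑ t ∈ Finset.Icc 2 T, (t : ℝ) ^ (-α) ≤ (1 - (T : ℝ) ^ (1 - α)) / (α - 1) := by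
    induction T, h using Nat.le_induction with
    | base => simp
    | succ T hT ih =>
      rw [Finset.sum_Icc_succ_top (by omega)]
      refine (add_le_add_left ih _).trans ?_
      have hT0 : (0 : ℝ) < T := by exact_mod_cast hT
      have hT1 : (0 : ℝ) < T + 1 := by positivity
      -- `(T / (T + 1)) ^ (1 - α) ≥ exp ((α - 1) / (T + 1)) ≥ 1 + (α - 1) / (T + 1)`
      have h1 : 1 + (α - 1) / (T + 1) ≤ ((T : ℝ) / (T + 1)) ^ (1 - α) := by
        have h2 : (T : ℝ) / (T + 1) ≤ Real.exp (-(1 / (T + 1))) := by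
          refine le_trans (le_of_eq ?_) (Real.add_one_le_exp _)
          field_simp; ring
        calc 1 + (α - 1) / (T + 1) ≤ Real.exp ((α - 1) / (T + 1)) := by
              rw [add_comm]; exact Real.add_one_le_exp _
          _ = Real.exp (-(1 / ((T : ℝ) + 1))) ^ (1 - α) := by
              rw [← Real.exp_mul]; congr 1; field_simp; ring
          _ ≤ _ := Real.rpow_le_rpow_of_nonpos (by positivity) h2 (by linarith)
      rw [Real.div_rpow hT0.le hT1.le, le_div_iff₀ (by positivity)] at h1
      push_cast
      have h3 : ((T : ℝ) + 1) ^ (-α) = ((T : ℝ) + 1) ^ (1 - α) / (T + 1) := by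
        rw [← Real.rpow_sub_one hT1.ne']; congr 1; ring
      rw [h3, le_div_iff₀ h0, add_mul, div_mul_cancel₀ _ h0.ne']
      have h4 : (1 + (α - 1) / (T + 1)) * ((T : ℝ) + 1) ^ (1 - α)
        = ((T : ℝ) + 1) ^ (1 - α) + ((T : ℝ) + 1) ^ (1 - α) / (T + 1) * (α - 1) := by ring
      linarith
  refine key.trans ?_
  gcongr
  linarith [Real.rpow_nonneg (T.cast_nonneg (α := ℝ)) (1 - α)]

/-! ### Reduction of the regret to deviation probabilities -/

section

variable {N : ℕ} {Ω : Type*} [MeasurableSpace Ω]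

theorem setCost_nonneg {M : ℕ} {C : Fin N → ℝ} (hC : ∀ j : Fin N, M ≤ (j : ℕ) → 0 < C j)
    (j : Fin N) : 0 ≤ setCost M C j := by
  unfold setCost
  split_ifs with h
  · exact le_rfl
  · exact (hC j (by omega)).le

theorem setCost_le_maxCost (M : ℕ) (C : Fin N → ℝ) (j : Fin N) : setCost M C j ≤ maxCost M C :=
  le_ciSup (f := fun j => setCost M C j) (Set.finite_range _).bddAbove j

theorem maxCost_nonneg {M : ℕ} {C : Fin N → ℝ} (hC : ∀ j : Fin N, M ≤ (j : ℕ) → 0 < C j) :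
    0 ≤ maxCost M C :=
  Real.iSup_nonneg fun j => setCost_nonneg hC j

/-- The exploration times up to `T` cost exactly what the observations of each arm cost. -/
theorem sum_explore_cost {M : ℕ} {g : ℕ → ℝ} {est : (Fin N → ℕ → ℝ) → Fin N → ℕ → ℝ}
    {X : Fin N → ℕ → Ω → ℝ} {play : ℕ → Ω → Fin N} (hplay : FollowsDSEE M g est X play)
    (φ : Fin N → ℝ) (T : ℕ) (ω : Ω) :
    ∑ t ∈ exploreSet g T, φ (play t ω) = ∑ n, (obsCount g n T : ℝ) * φ n := by
  rw [← Finset.sum_fiberwise (exploreSet g T) (fun t => play t ω)]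
  refine Finset.sum_congr rfl fun n _ => ?_
  have hset : (exploreSet g T).filter (fun t => play t ω = n) = obsTimes g n T := by
    refine Finset.filter_congr fun t ht => ?_
    have ht' := (mem_exploreSet_iff (one_lt_and_le_of_mem_exploreSet ht).2).1 ht
    rw [Fin.ext_iff, hplay.explore t ω ht']
  rw [hset, Finset.sum_congr rfl (g := fun _ => φ n), Finset.sum_const, nsmul_eq_mul, obsCount]
  intro t ht
  rw [← hset, Finset.mem_filter] at ht
  rw [ht.2]

/-- The regret splits into the deterministic cost of exploration and the cost of the exploitation
times at which an arm outside the `M` best ones is played. -/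
theorem regret_le {M : ℕ} {g : ℕ → ℝ} {est : (Fin N → ℕ → ℝ) → Fin N → ℕ → ℝ}
    {X : Fin N → ℕ → Ω → ℝ} {play : ℕ → Ω → Fin N} {μ : Measure Ω} [IsProbabilityMeasure μ]
    (hplay : FollowsDSEE M g est X play) (σ : Equiv.Perm (Fin N)) {C : Fin N → ℝ}
    (T : ℕ) :
    regret σ M C μ play T ≤ ∑ j, (obsCount g (σ j) T : ℝ) * setCost M C j +
      maxCost M C * ∑ t ∈ (Finset.Icc 1 T).filter (fun t => t ∉ exploreSet g t),
        μ.real {ω | M ≤ (σ.symm (play t ω) : ℕ)} := by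
  have hsub : (Finset.Icc 1 T).filter (fun t => t ∈ exploreSet g t) = exploreSet g T := by
    ext t
    rw [Finset.mem_filter, Finset.mem_Icc]
    constructor
    · rintro ⟨⟨_, h1⟩, h2⟩
      exact (mem_exploreSet_iff h1).2 h2
    · intro h
      have := one_lt_and_le_of_mem_exploreSet h
      exact ⟨⟨by omega, this.2⟩, (mem_exploreSet_iff this.2).1 h⟩
  have hmeas : ∀ t, MeasurableSet {ω | M ≤ (σ.symm (play t ω) : ℕ)} := fun t =>
    (hplay.measurable t) (MeasurableSet.of_discrete (s := {n : Fin N | M ≤ (σ.symm n : ℕ)}))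
  have hint : ∀ t, Integrable (fun ω => setCost M C (σ.symm (play t ω))) μ := fun t =>
    Integrable.of_bound (C := ∑ n, |setCost M C n|)
      ((measurable_of_finite fun n : Fin N => setCost M C (σ.symm n)).comp
        (hplay.measurable t)).aestronglyMeasurable
      (ae_of_all _ fun ω => Finset.single_le_sum (f := fun n => |setCost M C n|)
        (fun _ _ => abs_nonneg _) (Finset.mem_univ (σ.symm (play t ω))))
  rw [regret]
  simp_rw [← Finset.sum_filter_add_sum_filter_not (Finset.Icc 1 T)
    (fun t => t ∈ exploreSet g t), hsub,
    sum_explore_cost hplay (fun n => setCost M C (σ.symm n)) T]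
  rw [integral_add (integrable_const _) (integrable_finsetSum _ fun t _ => hint t),
    integral_const, integral_finsetSum _ fun t _ => hint t]
  refine add_le_add (le_of_eq ?_) ?_
  · simp only [probReal_univ, one_smul]
    rw [← Equiv.sum_comp σ]
    simp
  · rw [Finset.mul_sum]
    refine Finset.sum_le_sum fun t _ => ?_
    rw [← integral_indicator_one (hmeas t), ← integral_const_mul]
    refine integral_mono (hint t) ((Integrable.indicator (integrable_const _)
      (hmeas t)).const_mul _) fun ω => ?_
    by_cases h : M ≤ (σ.symm (play t ω) : ℕ)
    · simpa [Set.indicator, h] using setCost_le_maxCost M C _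
    · simp [Set.indicator, h, setCost, not_le.1 h]

/-- If every estimate is off by less than half of the gap, then the estimates of the `M` best arms
exceed all others, so an arm beaten by fewer than `M` others is one of the `M` best. -/
theorem rank_lt_of_estimates_close {M : ℕ} (hM : 1 ≤ M) (hMN : M < N) {F : Fin N → Measure ℝ}
    {σ : Equiv.Perm (Fin N)} (hσ : SortsArms F σ) {δ : ℝ} (hδ : 2 * δ ≤ gap F σ M hMN)
    {e : Fin N → ℝ} (he : ∀ n, |e n - mean (F n)| < δ) {i : Fin N}
    (hi : (Finset.univ.filter fun m : Fin N => e i < e m).card < M) : (σ.symm i : ℕ) < M := by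
  by_contra! hr
  refine absurd hi (not_lt.2 ?_)
  have hcard : ((Finset.univ : Finset (Fin M)).map
      ((Fin.castLEEmb hMN.le).trans σ.toEmbedding)).card = M := by simp
  rw [← hcard]
  refine Finset.card_le_card fun m hm => ?_
  simp only [Finset.mem_map, Finset.mem_univ, true_and, Finset.mem_filter] at hm ⊢
  obtain ⟨j, rfl⟩ := hm
  have h1 := hσ (Fin.castLE hMN.le j) ⟨M - 1, by omega⟩ (by simp [Fin.le_def]; omega)
  have h2 := hσ ⟨M, hMN⟩ (σ.symm i) (by simpa [Fin.le_def] using hr)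
  rw [Equiv.apply_symm_apply] at h2
  have h3 := (abs_lt.1 (he (σ (Fin.castLE hMN.le j)))).1
  have h4 := (abs_lt.1 (he i)).2
  simp only [gap, delta] at hδ
  simp only [Function.Embedding.trans_apply, Equiv.coe_toEmbedding, Fin.castLEEmb_apply]
  linarith

/-- An arm outside the `M` best ones is exploited only if some estimate is off by `δ`. -/
theorem measure_wrong_le {M : ℕ} (hM : 1 ≤ M) (hMN : M < N) {F : Fin N → Measure ℝ}
    {σ : Equiv.Perm (Fin N)} (hσ : SortsArms F σ) {δ : ℝ} (hδ : 2 * δ ≤ gap F σ M hMN)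
    {g : ℕ → ℝ} {est : (Fin N → ℕ → ℝ) → Fin N → ℕ → ℝ}
    {X : Fin N → ℕ → Ω → ℝ} {play : ℕ → Ω → Fin N} {μ : Measure Ω} [IsProbabilityMeasure μ]
    (hplay : FollowsDSEE M g est X play) {t : ℕ} (ht : 1 ≤ t) (hte : t ∉ exploreSet g t)
    (hobs : ∀ n : Fin N, 0 < obsCount g n (t - 1)) :
    μ.real {ω | M ≤ (σ.symm (play t ω) : ℕ)} ≤
      ∑ n, μ.real {ω | δ ≤ |est (fun n s => X n s ω) n t - mean (F n)|} := by
  refine (measureReal_mono ?_).trans (measureReal_iUnion_fintype_le _)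
  intro ω hω
  by_contra h
  simp only [Set.mem_iUnion, Set.mem_ofPred_eq, not_exists, not_le] at h
  exact absurd (rank_lt_of_estimates_close hM hMN hσ hδ h (hplay.exploit t ω ht hte hobs))
    (not_lt.2 hω)

/-- At an exploitation time `t > 1` the `N * ⌈v t⌉₊` explorations have been shared equally by
round-robin. -/
theorem ceil_le_obsCount {v : ℕ → ℝ} {g : ℕ → ℝ} (hg : ∀ t, g t = (N : ℝ) * (⌈v t⌉₊ : ℝ)) {t : ℕ}
    (ht : 1 < t) (hte : t ∉ exploreSet g t) (n : Fin N) : ⌈v t⌉₊ ≤ obsCount g n (t - 1) := by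
  have := le_card_exploreSet ht hte
  rw [hg] at this
  exact le_obsCount n (by exact_mod_cast this)

theorem obsCount_le_ceil {v : ℕ → ℝ} (hv : Monotone v) {g : ℕ → ℝ}
    (hg : ∀ t, g t = (N : ℝ) * (⌈v t⌉₊ : ℝ)) (T : ℕ) (n : Fin N) : obsCount g n T ≤ ⌈v T⌉₊ :=
  obsCount_le n (card_exploreSet_le_of_nat (m := fun t => N * ⌈v t⌉₊) (by simpa using hg)
    (fun _ _ h => Nat.mul_le_mul_left _ (Nat.ceil_mono (hv h))) T)

theorem monotone_log_natCast : Monotone fun t : ℕ => Real.log t := by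
  intro s t h
  rcases Nat.eq_zero_or_pos s with rfl | hs
  · simpa using Real.log_natCast_nonneg t
  · exact Real.log_le_log (by exact_mod_cast hs) (by exact_mod_cast h)

/-- The finite-time bound for logarithmic exploration: deviation probabilities `2 exp (-b τ)` after
`τ ≥ w log t` observations give a probability at most `2 N t ^ (-b w)` for a wrong exploitation at
time `t > 1`, and `b w > 1` makes these summable.  The summand `1` of the last factor pays for time
`1`, at which nothing has been observed. -/
theorem regret_le_of_exp_deviation {M : ℕ} (hM : 1 ≤ M) (hMN : M < N) {F : Fin N → Measure ℝ}
    {σ : Equiv.Perm (Fin N)} (hσ : SortsArms F σ) {δ : ℝ} (hδ : 2 * δ ≤ gap F σ M hMN)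
    {C : Fin N → ℝ} (hC : ∀ j : Fin N, M ≤ (j : ℕ) → 0 < C j) {b w : ℝ} (hb : 0 < b)
    (hw : 1 / b < w) {g : ℕ → ℝ} (hg : ∀ t, g t = (N : ℝ) * (⌈w * Real.log t⌉₊ : ℝ))
    {est : (Fin N → ℕ → ℝ) → Fin N → ℕ → ℝ}
    {X : Fin N → ℕ → Ω → ℝ} {play : ℕ → Ω → Fin N} {μ : Measure Ω} [IsProbabilityMeasure μ]
    (hplay : FollowsDSEE M g est X play)
    (hdev : ∀ n t, 0 < obsCount g n (t - 1) →
      μ.real {ω | δ ≤ |est (fun n s => X n s ω) n t - mean (F n)|} ≤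
        2 * Real.exp (-(b * (obsCount g n (t - 1) : ℝ)))) (T : ℕ) :
    regret σ M C μ play T ≤ ∑ j : Fin N, (⌈w * Real.log T⌉₊ : ℝ) * setCost M C j
      + 2 * (N : ℝ) * maxCost M C * (1 + 1 / (b * w - 1)) := by
  have hw0 : 0 < w := lt_trans (by positivity) hw
  have hbw : 1 < b * w := by rwa [div_lt_iff₀ hb, mul_comm] at hw
  have hN : (1 : ℝ) ≤ N := by exact_mod_cast (by omega : 1 ≤ N)
  have hmono : Monotone fun t : ℕ => w * Real.log t := monotone_log_natCast.const_mul hw0.le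
  refine (regret_le hplay σ T).trans (add_le_add ?_ ?_)
  · gcongr with j
    · exact setCost_nonneg hC j
    · exact obsCount_le_ceil hmono hg T _
  have hbad : ∀ t ∈ (Finset.Icc 2 T).filter (fun t => t ∉ exploreSet g t),
      μ.real {ω | M ≤ (σ.symm (play t ω) : ℕ)} ≤ 2 * N * (t : ℝ) ^ (-(b * w)) := by
    intro t ht
    rw [Finset.mem_filter, Finset.mem_Icc] at ht
    have ht0 : (0 : ℝ) < t := by exact_mod_cast (by omega : 0 < t)
    have hlog : 0 < Real.log t := Real.log_pos (by exact_mod_cast (by omega : 1 < t))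
    have hobs : ∀ n : Fin N, ⌈w * Real.log t⌉₊ ≤ obsCount g n (t - 1) :=
      ceil_le_obsCount hg (by omega) ht.2
    have hpos : ∀ n : Fin N, 0 < obsCount g n (t - 1) := fun n =>
      (Nat.ceil_pos.2 (by positivity)).trans_le (hobs n)
    refine (measure_wrong_le hM hMN hσ hδ hplay (by omega) ht.2 hpos).trans ?_
    calc _ ≤ ∑ n : Fin N, 2 * (t : ℝ) ^ (-(b * w)) := by
          refine Finset.sum_le_sum fun n _ => (hdev n t (hpos n)).trans ?_
          rw [Real.rpow_def_of_pos ht0]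
          have : w * Real.log t ≤ obsCount g n (t - 1) := Nat.ceil_le.1 (hobs n)
          gcongr
          nlinarith
      _ = _ := by simp; ring
  have hsum : ∑ t ∈ (Finset.Icc 1 T).filter (fun t => t ∉ exploreSet g t),
      μ.real {ω | M ≤ (σ.symm (play t ω) : ℕ)} ≤ 1 + 2 * N * (1 / (b * w - 1)) := by
    have hsplit : (Finset.Icc 1 T).filter (fun t => t ∉ exploreSet g t) ⊆
        insert 1 ((Finset.Icc 2 T).filter (fun t => t ∉ exploreSet g t)) := by
      intro t
      simp only [Finset.mem_filter, Finset.mem_Icc, Finset.mem_insert]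
      rintro ⟨⟨h1, h2⟩, h3⟩
      by_cases h : t = 1
      · exact Or.inl h
      · exact Or.inr ⟨⟨by omega, h2⟩, h3⟩
    refine (Finset.sum_le_sum_of_subset_of_nonneg hsplit
      fun _ _ _ => measureReal_nonneg).trans ?_
    rw [Finset.sum_insert (by simp)]
    refine add_le_add measureReal_le_one ((Finset.sum_le_sum hbad).trans ?_)
    refine (Finset.sum_le_sum_of_subset_of_nonneg (Finset.filter_subset _ _)
      fun _ _ _ => by positivity).trans ?_
    rw [← Finset.mul_sum]
    gcongr
    exact sum_Icc_two_rpow_neg_le hbw T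
  calc maxCost M C * _ ≤ maxCost M C * (1 + 2 * N * (1 / (b * w - 1))) :=
        mul_le_mul_of_nonneg_left hsum (maxCost_nonneg hC)
    _ ≤ maxCost M C * (2 * N + 2 * N * (1 / (b * w - 1))) := by
        gcongr
        · exact maxCost_nonneg hC
        · linarith
    _ = _ := by ring

end

/-! ### Exponential deviation bounds -/

section Chernoff

variable {Ω ι : Type*} [MeasurableSpace Ω] {μ : Measure Ω}

/-- One-sided Chernoff bound for a sum of independent, not necessarily identically distributed
variables, in terms of bounds on their moment generating functions at `l`. -/
theorem measure_sum_ge_le_of_mgf_le {Z : ι → Ω → ℝ} (hindep : iIndepFun Z μ)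
    (hmeas : ∀ i, Measurable (Z i)) (S : Finset ι) {l x : ℝ} {m : ι → ℝ} (hl : 0 ≤ l)
    (hint : ∀ i, Integrable (fun ω => Real.exp (l * Z i ω)) μ)
    (hmgf : ∀ i ∈ S, mgf (Z i) μ l ≤ Real.exp (m i)) :
    μ.real {ω | x ≤ ∑ i ∈ S, Z i ω} ≤ Real.exp (-(l * x) + ∑ i ∈ S, m i) := by
  have := hindep.isProbabilityMeasure
  have h := measure_ge_le_exp_mul_mgf (X := ∑ i ∈ S, Z i) (μ := μ) x hl
    (hindep.integrable_exp_mul_sum hmeas fun i _ => hint i)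
  rw [hindep.mgf_sum hmeas] at h
  simp only [Finset.sum_apply] at h
  refine h.trans ?_
  rw [Real.exp_add, Real.exp_sum, neg_mul]
  gcongr with i hi
  · intro i _; exact mgf_nonneg
  · exact hmgf i hi

/-- Two-sided Chernoff bound for an average of independent variables. -/
theorem measure_abs_average_sub_ge_le {Z : ι → Ω → ℝ} (hindep : iIndepFun Z μ)
    (hmeas : ∀ i, Measurable (Z i)) {S : Finset ι} (hS : S.Nonempty) {l δ θ : ℝ} {m : ι → ℝ}
    (hl : 0 ≤ l) (hint : ∀ i, Integrable (fun ω => Real.exp (l * Z i ω)) μ)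
    (hint' : ∀ i, Integrable (fun ω => Real.exp (-l * Z i ω)) μ)
    (hmgf : ∀ i ∈ S, mgf (Z i) μ l ≤ Real.exp (l * θ + m i))
    (hmgf' : ∀ i ∈ S, mgf (Z i) μ (-l) ≤ Real.exp (-l * θ + m i)) :
    μ.real {ω | δ ≤ |(∑ i ∈ S, Z i ω) / (S.card : ℝ) - θ|} ≤
      2 * Real.exp (-(l * δ * S.card) + ∑ i ∈ S, m i) := by
  have := hindep.isProbabilityMeasure
  have hc : (0 : ℝ) < S.card := by exact_mod_cast hS.card_pos
  have h1 := measure_sum_ge_le_of_mgf_le hindep hmeas S (x := S.card * (θ + δ)) hl hint hmgf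
  have hneg : iIndepFun (fun i ω => -Z i ω) μ :=
    hindep.comp (fun _ => Neg.neg) fun _ => measurable_neg
  have h2 := measure_sum_ge_le_of_mgf_le hneg (fun i => (hmeas i).neg) S
    (x := S.card * (δ - θ)) (m := fun i => -l * θ + m i) hl (fun i => by simpa using hint' i)
    (fun i hi => by
      have := hmgf' i hi
      rwa [← mgf_neg] at this)
  have hsub : {ω | δ ≤ |(∑ i ∈ S, Z i ω) / (S.card : ℝ) - θ|} ⊆
      {ω | S.card * (θ + δ) ≤ ∑ i ∈ S, Z i ω} ∪ {ω | S.card * (δ - θ) ≤ ∑ i ∈ S, -Z i ω} := by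
    intro ω hω
    simp only [Set.mem_ofPred_eq, Set.mem_union, Finset.sum_neg_distrib] at hω ⊢
    rcases le_abs.1 hω with h | h
    · left
      rw [le_sub_iff_add_le, le_div_iff₀ hc] at h
      linarith
    · right
      rw [neg_sub, le_sub_comm, div_le_iff₀ hc] at h
      linarith
  refine ((measureReal_mono hsub).trans (measureReal_union_le _ _)).trans
    ((add_le_add h1 h2).trans (le_of_eq ?_))
  simp only [Finset.sum_add_distrib, Finset.sum_const, nsmul_eq_mul]
  rw [two_mul]
  congr 2 <;> ring

/-- Chernoff bound for the sample mean of identically distributed variables. -/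
theorem sampleMean_deviation_le {X : ι → Ω → ℝ} {D : Measure ℝ} [IsProbabilityMeasure D]
    (hindep : iIndepFun X μ) (hmeas : ∀ i, Measurable (X i)) (hlaw : ∀ i, μ.map (X i) = D)
    {S : Finset ι} (hS : S.Nonempty) {l δ κ : ℝ} (hl : 0 ≤ l)
    (hint : Integrable (fun x => Real.exp (l * x)) D)
    (hint' : Integrable (fun x => Real.exp (-l * x)) D)
    (hmgf : mgf (fun x => x - mean D) D l ≤ Real.exp κ)
    (hmgf' : mgf (fun x => x - mean D) D (-l) ≤ Real.exp κ) :
    μ.real {ω | δ ≤ |(∑ i ∈ S, X i ω) / (S.card : ℝ) - mean D|} ≤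
      2 * Real.exp (-((l * δ - κ) * S.card)) := by
  have hmap : ∀ r, Integrable (fun x => Real.exp (r * x)) D →
      ∀ i, Integrable (fun ω => Real.exp (r * X i ω)) μ := fun r h i =>
    (integrable_map_measure (f := X i) (g := fun x => Real.exp (r * x)) (by fun_prop)
      (hmeas i).aemeasurable).1 ((hlaw i).symm ▸ h)
  have hm : ∀ r i, mgf (fun x => x - mean D) D r ≤ Real.exp κ →
      mgf (X i) μ r ≤ Real.exp (r * mean D + κ) := fun r i h => by
    simp only [sub_eq_add_neg] at h
    rw [mgf_add_const] at h
    have hid := congrFun (mgf_id_map (μ := μ) (hmeas i).aemeasurable) r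
    rw [hlaw i] at hid
    rw [← hid, Real.exp_add, mul_comm, ← div_le_iff₀ (Real.exp_pos _), div_eq_mul_inv,
      ← Real.exp_neg, ← mul_neg]
    exact h
  refine (measure_abs_average_sub_ge_le hindep hmeas hS (m := fun _ => κ) hl (hmap l hint)
    (hmap (-l) hint') (fun i _ => hm l i hmgf) fun i _ => hm (-l) i hmgf').trans (le_of_eq ?_)
  simp only [Finset.sum_const, nsmul_eq_mul]
  congr 2
  ring

end Chernoff

theorem integrable_exp_mul_sub {D : Measure ℝ} {r : ℝ} (m : ℝ)
    (h : Integrable (fun x => Real.exp (r * x)) D) :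
    Integrable (fun x => Real.exp (r * (x - m))) D := by
  simp_rw [mul_sub, Real.exp_sub]
  exact h.div_const _

/-- If the exponential moments exist on `[-u₀, u₀]`, the moment generating function of the centred
variable is smooth on the open interval. -/
theorem Ioo_subset_interior_integrableExpSet {D : Measure ℝ} {u₀ : ℝ}
    (h : ∀ u : ℝ, |u| ≤ u₀ → Integrable (fun x : ℝ => Real.exp (u * x)) D) (m : ℝ) :
    Set.Ioo (-u₀) u₀ ⊆ interior (integrableExpSet (fun x => x - m) D) :=
  interior_maximal (fun u hu => integrable_exp_mul_sub m (h u (abs_le.2 ⟨hu.1.le, hu.2.le⟩)))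
    isOpen_Ioo

theorem integral_sub_mean {D : Measure ℝ} [IsProbabilityMeasure D]
    (hD : Integrable (fun x : ℝ => x) D) : ∫ x, (x - mean D) ∂D = 0 := by
  rw [integral_sub hD (integrable_const _)]
  simp [mean]

/-- A bound `ζ` on the second derivative makes `u ↦ ζ u² / 2 - mgf u` convex; it is stationary at
`0`, so it is minimal there. -/
theorem mgf_centered_le_exp {D : Measure ℝ} [IsProbabilityMeasure D]
    (hD : Integrable (fun x : ℝ => x) D) {ζ u₀ : ℝ} (h : LightTailedWith D ζ u₀) {u : ℝ}
    (hu : |u| < u₀) : mgf (fun x => x - mean D) D u ≤ Real.exp (ζ * u ^ 2 / 2) := by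
  set Y : ℝ → ℝ := fun x => x - mean D
  have hu0 : 0 < u₀ := (abs_nonneg u).trans_lt hu
  have hsub := Ioo_subset_interior_integrableExpSet h.1 (mean D)
  have h0 : (0 : ℝ) ∈ Set.Ioo (-u₀) u₀ := ⟨by linarith, hu0⟩
  have hd1 : ∀ v ∈ Set.Ioo (-u₀) u₀, HasDerivAt (fun u => ζ * u ^ 2 / 2 - mgf Y D u)
      (ζ * v - deriv (mgf Y D) v) v := fun v hv => by
    have := (differentiableAt_mgf (hsub hv)).hasDerivAt
    have h2 : HasDerivAt (fun u : ℝ => ζ * u ^ 2 / 2) (ζ * v) v := by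
      convert! ((hasDerivAt_pow 2 v).const_mul ζ).div_const 2 using 1
      push_cast; ring
    exact h2.sub this
  have hd2 : ∀ v ∈ Set.Ioo (-u₀) u₀, HasDerivAt (fun u => ζ * u - deriv (mgf Y D) u)
      (ζ - iteratedDeriv 2 (mgf Y D) v) v := fun v hv => by
    have h1 := hasDerivAt_iteratedDeriv_mgf (hsub hv) 1
    rw [← iteratedDeriv_mgf (hsub hv), iteratedDeriv_one] at h1
    have h2 : HasDerivAt (fun u : ℝ => ζ * u) ζ v := by
      simpa using (hasDerivAt_id v).const_mul ζ
    exact h2.sub h1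
  have hconv : ConvexOn ℝ (Set.Ioo (-u₀) u₀) (fun u => ζ * u ^ 2 / 2 - mgf Y D u) := by
    refine convexOn_of_hasDerivWithinAt2_nonneg (convex_Ioo _ _)
      (f' := fun v => ζ * v - deriv (mgf Y D) v) (f'' := fun v => ζ - iteratedDeriv 2 (mgf Y D) v)
      (fun v hv => (hd1 v hv).continuousAt.continuousWithinAt) ?_ ?_ ?_ <;>
      rw [interior_Ioo]
    · exact fun v hv => (hd1 v hv).hasDerivWithinAt
    · exact fun v hv => (hd2 v hv).hasDerivWithinAt
    · exact fun v hv => sub_nonneg.2 (h.2 v (abs_lt.2 hv))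
  have hmin := hconv.isMinOn_of_rightDeriv_eq_zero (x := 0) (by rwa [interior_Ioo]) (by
    rw [(hd1 0 h0).hasDerivWithinAt.derivWithin (uniqueDiffWithinAt_Ioi 0),
      deriv_mgf_zero (hsub h0), integral_sub_mean hD]
    ring)
  have := hmin (abs_lt.1 hu : u ∈ Set.Ioo (-u₀) u₀)
  simp only [Set.mem_ofPred_eq, mgf_zero] at this
  have h3 := Real.add_one_le_exp (ζ * u ^ 2 / 2)
  linarith

/-- The Chernoff-Hoeffding inequality with rate `1 / (2 ζ)`.  The optimal parameter `δ / ζ` may be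
the end point `u₀`, where nothing is known of the derivatives; it is reached as a limit. -/
theorem sampleMean_deviation_le_of_lightTailedWith {Ω ι : Type*} [MeasurableSpace Ω] {μ : Measure Ω}
    {X : ι → Ω → ℝ} {D : Measure ℝ} [IsProbabilityMeasure D] (hD : Integrable (fun x : ℝ => x) D)
    (hindep : iIndepFun X μ) (hmeas : ∀ i, Measurable (X i)) (hlaw : ∀ i, μ.map (X i) = D)
    {S : Finset ι} (hS : S.Nonempty) {δ ζ u₀ : ℝ} (hζ : 0 < ζ) (hδ : 0 < δ)
    (hδu : δ ≤ ζ * u₀) (h : LightTailedWith D ζ u₀) :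
    μ.real {ω | δ ≤ |(∑ i ∈ S, X i ω) / (S.card : ℝ) - mean D|} ≤
      2 * Real.exp (-(1 / (2 * ζ) * δ ^ 2 * S.card)) := by
  have hlim : Tendsto (fun l : ℝ => 2 * Real.exp (-((l * δ - ζ * l ^ 2 / 2) * S.card)))
      (nhdsWithin (δ / ζ) (Set.Iio (δ / ζ)))
      (nhds (2 * Real.exp (-((δ / ζ * δ - ζ * (δ / ζ) ^ 2 / 2) * S.card)))) :=
    Continuous.continuousWithinAt (by fun_prop)
  have hval : (δ / ζ * δ - ζ * (δ / ζ) ^ 2 / 2) = 1 / (2 * ζ) * δ ^ 2 := by field_simp; ring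
  rw [hval] at hlim
  refine ge_of_tendsto hlim ?_
  have hpos : 0 < δ / ζ := by positivity
  filter_upwards [Ioo_mem_nhdsLT hpos] with l hl
  have hlu : l < u₀ := hl.2.trans_le ((div_le_iff₀ hζ).2 (by linarith))
  have habs : |l| < u₀ := by rwa [abs_of_pos hl.1]
  exact sampleMean_deviation_le hindep hmeas hlaw hS hl.1.le (h.1 l habs.le)
    (h.1 (-l) (by rw [abs_neg]; exact habs.le)) (mgf_centered_le_exp hD h habs)
    (by simpa using mgf_centered_le_exp hD h (u := -l) (by rwa [abs_neg]))

/-- Without quantitative knowledge, light tails still give some exponential rate: the centred moment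
generating function has derivative `0` at `0`, so it is at most `exp (l δ / 2)` for small `l`. -/
theorem exists_mgf_centered_le {D : Measure ℝ} [IsProbabilityMeasure D]
    (hD : Integrable (fun x : ℝ => x) D) (h : LightTailed D) {δ : ℝ} (hδ : 0 < δ) :
    ∃ l : ℝ, 0 < l ∧ Integrable (fun x => Real.exp (l * x)) D ∧
      Integrable (fun x => Real.exp (-l * x)) D ∧
      mgf (fun x => x - mean D) D l ≤ Real.exp (l * δ / 2) ∧
      mgf (fun x => x - mean D) D (-l) ≤ Real.exp (l * δ / 2) := by
  obtain ⟨u₀, hu0, hu⟩ := h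
  have h0 := Ioo_subset_interior_integrableExpSet hu (mean D)
    (⟨by linarith, hu0⟩ : (0 : ℝ) ∈ Set.Ioo (-u₀) u₀)
  have hd := (differentiableAt_mgf h0).hasDerivAt
  rw [deriv_mgf_zero h0, integral_sub_mean hD, hasDerivAt_iff_isLittleO] at hd
  have hev := hd.def (half_pos hδ)
  obtain ⟨ε, hε, hball⟩ := Metric.eventually_nhds_iff.1 hev
  have key : ∀ r : ℝ, |r| < ε →
      mgf (fun x => x - mean D) D r ≤ Real.exp (|r| * δ / 2) := fun r hr => by
    have := hball (y := r) (by simpa using hr)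
    simp only [mgf_zero, sub_zero, smul_zero, Real.norm_eq_abs] at this
    have h2 := Real.add_one_le_exp (|r| * δ / 2)
    have h3 := (abs_le.1 this).2
    linarith
  have hl0 : 0 < min (ε / 2) u₀ := by positivity
  have hlε : |min (ε / 2) u₀| < ε := by
    rw [abs_of_pos hl0]; exact (min_le_left _ _).trans_lt (by linarith)
  have hlu : |min (ε / 2) u₀| ≤ u₀ := by rw [abs_of_pos hl0]; exact min_le_right _ _
  refine ⟨_, hl0, hu _ hlu, hu _ (by rwa [abs_neg]), ?_, ?_⟩
  · simpa only [abs_of_pos hl0] using key _ hlε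
  · simpa only [abs_neg, abs_of_pos hl0] using key (-min (ε / 2) u₀) (by rwa [abs_neg])

/-- The Chernoff-Hoeffding inequality, which is stated for product measures, transfers to the
observations of an arm. -/
theorem sampleMean_deviation_le_of_chernoffHolds {Ω ι : Type*} [MeasurableSpace Ω] {μ : Measure Ω}
    {X : ι → Ω → ℝ} {D : Measure ℝ}
    (hindep : iIndepFun X μ) (hmeas : ∀ i, Measurable (X i)) (hlaw : ∀ i, μ.map (X i) = D)
    {S : Finset ι} (hS : S.Nonempty) {a δ ζ u₀ : ℝ} (hδ : 0 ≤ δ)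
    (hδu : δ ≤ ζ * u₀) (h : ChernoffHolds D a ζ u₀) :
    μ.real {ω | δ ≤ |(∑ i ∈ S, X i ω) / (S.card : ℝ) - mean D|} ≤
      2 * Real.exp (-(a * δ ^ 2 * S.card)) := by
  have := hindep.isProbabilityMeasure
  refine le_of_eq_of_le ?_ (h δ hδ hδu S.card hS.card_pos)
  have hY := hindep.precomp (g := fun i : Fin S.card => (S.equivFin.symm i : ι))
    (Subtype.val_injective.comp S.equivFin.symm.injective)
  have hmap := hY.map_fun_eq_pi_map fun i => (hmeas _).aemeasurable
  simp only [hlaw] at hmap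
  rw [← hmap, map_measureReal_apply (by fun_prop) (measurableSet_le (by fun_prop) (by fun_prop))]
  congr 1
  ext ω
  have hsum : ∑ i : Fin S.card, X (S.equivFin.symm i) ω = ∑ i ∈ S, X i ω := by
    rw [Equiv.sum_comp S.equivFin.symm (fun i : S => X i ω), Finset.sum_coe_sort S fun i => X i ω]
  simp [hsum]

/-! ### Truncated variables -/

/-- Truncation at level `B`: the identity on `[-B, B]`, zero elsewhere. -/
def trunc (B x : ℝ) : ℝ := if |x| ≤ B then x else 0

@[fun_prop]
theorem measurable_trunc (B : ℝ) : Measurable (trunc B) :=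
  Measurable.ite (measurableSet_le (by fun_prop) measurable_const) measurable_id measurable_const

theorem abs_trunc_le (B x : ℝ) : |trunc B x| ≤ |B| := by
  unfold trunc
  split_ifs with h
  · exact h.trans (le_abs_self B)
  · simp

theorem integrable_exp_mul_trunc {Ω : Type*} [MeasurableSpace Ω] {μ : Measure Ω} [IsFiniteMeasure μ]
    {X : Ω → ℝ} (hX : Measurable X) (B r : ℝ) :
    Integrable (fun ω => Real.exp (r * trunc B (X ω))) μ :=
  integrable_exp_mul_of_mem_Icc (a := -|B|) (b := |B|) (by fun_prop)
    (ae_of_all _ fun ω => abs_le.1 (abs_trunc_le B (X ω)))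

/-- The bias and the second moment of a truncated variable are both controlled by a moment of order
`q ∈ (1, 2]`.  They are estimated together: where `|x| ≤ B` the remainder of the exponential is at
most `κ r² x² ≤ κ r² B ^ (2 - q) |x| ^ q`, and where `|x| > B` the missing linear term is at most
`|r| B ^ (1 - q) |x| ^ q`. -/
theorem mgf_trunc_le {D : Measure ℝ} [IsProbabilityMeasure D] (hD : Integrable (fun x : ℝ => x) D)
    {q u : ℝ} (hq : 1 < q) (hq2 : q ≤ 2) (hint : Integrable (fun x : ℝ => |x| ^ q) D)
    (hu : ∫ x, |x| ^ q ∂D ≤ u) {B r c κ : ℝ} (hB : 0 < B) (hκ0 : 0 ≤ κ) (hrB : |r| * B ≤ c)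
    (hκ : ∀ x : ℝ, |x| ≤ c → Real.exp x ≤ 1 + x + κ * x ^ 2) :
    mgf (trunc B) D r ≤
      Real.exp (r * mean D + (|r| * u * B ^ (1 - q) + κ * r ^ 2 * u * B ^ (2 - q))) := by
  set A : ℝ := |r| * B ^ (1 - q) + κ * r ^ 2 * B ^ (2 - q) with hA
  have hA0 : 0 ≤ A := by positivity
  have hpt : ∀ x : ℝ, Real.exp (r * trunc B x) ≤ 1 + r * x + A * |x| ^ q := by
    intro x
    have hxq : 0 ≤ |x| ^ q := by positivity
    unfold trunc
    split_ifs with h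
    · have h1 := hκ (r * x) (by
        rw [abs_mul]
        exact (mul_le_mul_of_nonneg_left h (abs_nonneg r)).trans hrB)
      have h2 : x ^ 2 ≤ B ^ (2 - q) * |x| ^ q := by
        rcases eq_or_ne x 0 with rfl | hx
        · simpa using mul_nonneg (Real.rpow_nonneg hB.le _) hxq
        · calc x ^ 2 = |x| ^ (2 - q) * |x| ^ q := by
                rw [← Real.rpow_add (abs_pos.2 hx), sub_add_cancel, Real.rpow_two, sq_abs]
            _ ≤ _ := by
                gcongr
      have h3 : κ * (r * x) ^ 2 ≤ κ * r ^ 2 * B ^ (2 - q) * |x| ^ q := by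
        calc κ * (r * x) ^ 2 = κ * r ^ 2 * x ^ 2 := by ring
          _ ≤ κ * r ^ 2 * (B ^ (2 - q) * |x| ^ q) := by gcongr
          _ = _ := by ring
      have h4 : 0 ≤ |r| * B ^ (1 - q) * |x| ^ q := by positivity
      rw [hA, add_mul]
      linarith
    · rw [not_le] at h
      have hx : 0 < |x| := hB.trans h
      have h2 : |x| ≤ B ^ (1 - q) * |x| ^ q := by
        calc |x| = |x| ^ (1 - q) * |x| ^ q := by
              rw [← Real.rpow_add hx, sub_add_cancel, Real.rpow_one]
          _ ≤ _ := by
              gcongr ?_ * _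
              exact Real.rpow_le_rpow_of_nonpos hB h.le (by linarith)
      have h3 : -(r * x) ≤ |r| * B ^ (1 - q) * |x| ^ q := by
        calc -(r * x) ≤ |r| * |x| := by rw [← abs_mul]; exact neg_le_abs _
          _ ≤ |r| * (B ^ (1 - q) * |x| ^ q) := by gcongr
          _ = _ := by ring
      have h4 : 0 ≤ κ * r ^ 2 * B ^ (2 - q) * |x| ^ q := by positivity
      rw [mul_zero, Real.exp_zero, hA, add_mul]
      linarith
  have hI : Integrable (fun x : ℝ => 1 + r * x + A * |x| ^ q) D :=
    ((integrable_const _).add (hD.const_mul r)).add (hint.const_mul A)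
  have h1 : mgf (trunc B) D r ≤ ∫ x, (1 + r * x + A * |x| ^ q) ∂D :=
    integral_mono (integrable_exp_mul_trunc measurable_id B r) hI hpt
  have hI1 : Integrable (fun x : ℝ => 1 + r * x) D := (integrable_const _).add (hD.const_mul r)
  rw [integral_add hI1 (hint.const_mul A), integral_add (integrable_const _) (hD.const_mul r),
    integral_const_mul, integral_const_mul, integral_const, probReal_univ, one_smul] at h1
  have h2 : A * ∫ x, |x| ^ q ∂D ≤ A * u := by gcongr
  have h3 := Real.add_one_le_exp (r * mean D + A * u)
  have h4 : |r| * u * B ^ (1 - q) + κ * r ^ 2 * u * B ^ (2 - q) = A * u := by rw [hA]; ring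
  rw [h4]
  change mgf (trunc B) D r ≤ 1 + r * mean D + A * ∫ x, |x| ^ q ∂D at h1
  linarith

theorem exp_le_of_abs_le {c x : ℝ} (hx : |x| ≤ c) :
    Real.exp x ≤ 1 + x + Real.exp c * x ^ 2 := by
  have h := Complex.norm_exp_sub_sum_le_norm_mul_exp (x : ℂ) 2
  simp only [Finset.sum_range_succ, Finset.sum_range_zero, pow_zero, pow_one, Nat.factorial_zero,
    Nat.factorial_one, Nat.cast_one, div_one, zero_add, Complex.norm_real, Real.norm_eq_abs,
    sq_abs] at h
  rw [← Complex.ofReal_exp, ← Complex.ofReal_one, ← Complex.ofReal_add, ← Complex.ofReal_sub,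
    Complex.norm_real, Real.norm_eq_abs] at h
  have h1 := (abs_le.1 h).2
  have h2 : x ^ 2 * Real.exp |x| ≤ Real.exp c * x ^ 2 := by
    rw [mul_comm]; gcongr
  linarith

theorem exp_le_of_abs_le_one {x : ℝ} (hx : |x| ≤ 1) : Real.exp x ≤ 1 + x + 1 * x ^ 2 := by
  have := (abs_le.1 (Real.abs_exp_sub_one_sub_id_le hx)).2
  linarith

theorem mgf_trunc_comp {Ω : Type*} [MeasurableSpace Ω] {μ : Measure Ω} {D : Measure ℝ}
    {Y : Ω → ℝ} (hmeas : Measurable Y) (hlaw : μ.map Y = D) (B r : ℝ) :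
    mgf (fun ω => trunc B (Y ω)) μ r = mgf (trunc B) D r := by
  rw [← hlaw, mgf_map hmeas.aemeasurable (by fun_prop)]
  rfl

section

variable {Ω ι : Type*} [MeasurableSpace Ω] {μ : Measure Ω} {X : ι → Ω → ℝ} {D : Measure ℝ}
  [IsProbabilityMeasure D]

/-- Deviation of an average of truncated variables, with a truncation level that may depend on the
index. -/
theorem measure_abs_average_trunc_sub_ge_le (hindep : iIndepFun X μ)
    (hmeas : ∀ i, Measurable (X i)) (hlaw : ∀ i, μ.map (X i) = D)
    (hD : Integrable (fun x : ℝ => x) D)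
    {q u : ℝ} (hq : 1 < q) (hq2 : q ≤ 2) (hint : Integrable (fun x : ℝ => |x| ^ q) D)
    (hu : ∫ x, |x| ^ q ∂D ≤ u) {S : Finset ι} (hS : S.Nonempty) {B : ι → ℝ} {l δ c κ : ℝ}
    (hl : 0 ≤ l) (hB : ∀ i ∈ S, 0 < B i) (hκ0 : 0 ≤ κ) (hlB : ∀ i ∈ S, l * B i ≤ c)
    (hκ : ∀ x : ℝ, |x| ≤ c → Real.exp x ≤ 1 + x + κ * x ^ 2) :
    μ.real {ω | δ ≤ |(∑ i ∈ S, trunc (B i) (X i ω)) / (S.card : ℝ) - mean D|} ≤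
      2 * Real.exp (-(l * δ * S.card) +
        ∑ i ∈ S, (l * u * B i ^ (1 - q) + κ * l ^ 2 * u * B i ^ (2 - q))) := by
  have := hindep.isProbabilityMeasure
  refine measure_abs_average_sub_ge_le (hindep.comp (fun i => trunc (B i)) fun i => by fun_prop)
    (fun i => (measurable_trunc _).comp (hmeas i)) hS hl
    (fun i => integrable_exp_mul_trunc (hmeas i) _ _)
    (fun i => integrable_exp_mul_trunc (hmeas i) _ _) (fun i hi => ?_) (fun i hi => ?_)
  · have h := mgf_trunc_le hD hq hq2 hint hu (r := l) (hB i hi) hκ0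
      (by rw [abs_of_nonneg hl]; exact hlB i hi) hκ
    rw [abs_of_nonneg hl] at h
    exact (mgf_trunc_comp (hmeas i) (hlaw i) (B i) l).trans_le h
  · have h := mgf_trunc_le hD hq hq2 hint hu (r := -l) (hB i hi) hκ0
      (by rw [abs_neg, abs_of_nonneg hl]; exact hlB i hi) hκ
    rw [abs_neg, abs_of_nonneg hl, neg_sq] at h
    exact (mgf_trunc_comp (hmeas i) (hlaw i) (B i) (-l)).trans_le h

theorem measure_lt_abs_le {Y : Ω → ℝ} (hmeas : Measurable Y) (hlaw : μ.map Y = D)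
    {p B : ℝ} (hp : 0 < p) (hint : Integrable (fun x : ℝ => |x| ^ p) D) (hB : 0 < B) :
    μ.real {ω | B < |Y ω|} ≤ (∫ x, |x| ^ p ∂D) * B ^ (-p) := by
  have h1 : μ.real {ω | B < |Y ω|} = D.real {x | B < |x|} := by
    rw [← hlaw, map_measureReal_apply hmeas (measurableSet_lt measurable_const (by fun_prop))]
    rfl
  have h2 := mul_meas_ge_le_integral_of_nonneg (ae_of_all D fun x : ℝ => by positivity) hint
    (B ^ p)
  rw [h1, Real.rpow_neg hB.le, ← div_eq_mul_inv, le_div_iff₀ (by positivity), mul_comm]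
  refine le_trans ?_ h2
  gcongr
  · exact measure_ne_top _ _
  · exact fun hx => Real.rpow_le_rpow hB.le (le_of_lt hx) hp.le

/-- Deviation of a sample mean by truncation: either some observation exceeds `B`, or the mean of
the truncated observations deviates. -/
theorem sampleMean_deviation_le_of_trunc (hindep : iIndepFun X μ)
    (hmeas : ∀ i, Measurable (X i)) (hlaw : ∀ i, μ.map (X i) = D)
    (hD : Integrable (fun x : ℝ => x) D) {p q u : ℝ} (hp : 0 < p)
    (hintp : Integrable (fun x : ℝ => |x| ^ p) D)
    (hq : 1 < q) (hq2 : q ≤ 2) (hint : Integrable (fun x : ℝ => |x| ^ q) D)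
    (hu : ∫ x, |x| ^ q ∂D ≤ u) {S : Finset ι} (hS : S.Nonempty) {B l δ : ℝ}
    (hl : 0 ≤ l) (hB : 0 < B) :
    μ.real {ω | δ ≤ |(∑ i ∈ S, X i ω) / (S.card : ℝ) - mean D|} ≤
      S.card * ((∫ x, |x| ^ p ∂D) * B ^ (-p)) + 2 * Real.exp (-(l * δ * S.card) +
        S.card * (l * u * B ^ (1 - q) + Real.exp (l * B) * l ^ 2 * u * B ^ (2 - q))) := by
  have := hindep.isProbabilityMeasure
  have h1 := measure_abs_average_trunc_sub_ge_le hindep hmeas hlaw hD hq hq2 hint hu hS (δ := δ)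
    (B := fun _ => B) hl (fun _ _ => hB) (Real.exp_pos (l * B)).le (fun _ _ => le_rfl)
    fun x hx => exp_le_of_abs_le hx
  rw [Finset.sum_const, nsmul_eq_mul] at h1
  have h2 : μ.real (⋃ i ∈ S, {ω | B < |X i ω|}) ≤ S.card * ((∫ x, |x| ^ p ∂D) * B ^ (-p)) := by
    refine (measureReal_biUnion_finset_le _ _).trans ?_
    rw [← nsmul_eq_mul]
    exact Finset.sum_le_card_nsmul _ _ _ fun i _ => measure_lt_abs_le (hmeas i) (hlaw i) hp hintp hB
  refine (measureReal_mono ?_).trans ((measureReal_union_le _ _).trans (add_le_add h2 h1))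
  intro ω hω
  by_cases h : ∀ i ∈ S, |X i ω| ≤ B
  · right
    rw [Set.mem_ofPred_eq] at hω ⊢
    have heq : ∀ i ∈ S, trunc B (X i ω) = X i ω := fun i hi => if_pos (h i hi)
    rwa [Finset.sum_congr rfl heq]
  · left
    push Not at h
    simpa using h

end

/-- A finite moment of order `p > 1` makes the deviation probabilities of the sample mean decay like
`s ^ (1 - p)`.  The truncation level is proportional to the sample size `s`, and the Chernoff
parameter `(p - 1) log s / (δ s)` is chosen so that the truncated part contributes the same power of
`s`, with an exponential remainder that stays bounded. -/
theorem exists_polynomial_deviation_bound {D : Measure ℝ} [IsProbabilityMeasure D]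
    (hD : Integrable (fun x : ℝ => x) D) {p : ℝ} (hp : 1 < p)
    (hint : Integrable (fun x : ℝ => |x| ^ p) D) {δ : ℝ} (hδ : 0 < δ) :
    ∃ K : ℝ, ∀ (Ω : Type u) [MeasurableSpace Ω] (μ : Measure Ω) (X : ℕ → Ω → ℝ),
      iIndepFun X μ → (∀ i, Measurable (X i)) → (∀ i, μ.map (X i) = D) →
      ∀ S : Finset ℕ, S.Nonempty →
        μ.real {ω | δ ≤ |(∑ i ∈ S, X i ω) / (S.card : ℝ) - mean D|} ≤
          K * (S.card : ℝ) ^ (-(p - 1)) := by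
  set q : ℝ := min p 2 with hqdef
  have hq : 1 < q := lt_min hp one_lt_two
  have hq2 : q ≤ 2 := min_le_right _ _
  have hintq : Integrable (fun x : ℝ => |x| ^ q) D := by
    refine ((integrable_const (1 : ℝ)).add hint).mono'
      (Measurable.aestronglyMeasurable (by fun_prop)) (ae_of_all _ fun x => ?_)
    rw [Real.norm_of_nonneg (by positivity)]
    have hxp : 0 ≤ |x| ^ p := by positivity
    rcases le_total |x| 1 with h | h
    · have := Real.rpow_le_one (abs_nonneg x) h (by linarith : 0 ≤ q)
      simp only [Pi.add_apply]
      linarith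
    · have := Real.rpow_le_rpow_of_exponent_le h (min_le_left p 2)
      simp only [Pi.add_apply]
      linarith
  set u : ℝ := ∫ x, |x| ^ q ∂D with hu
  have hu0 : 0 ≤ u := integral_nonneg fun x => by positivity
  set m : ℝ := ∫ x, |x| ^ p ∂D with hm
  set r : ℝ := p - 1 with hr
  have hr0 : 0 < r := by linarith
  set η : ℝ := (q - 1) / 2 with hη
  have hη0 : 0 < η := by linarith
  set ε : ℝ := η * δ / r with hε
  have hε0 : 0 < ε := by positivity
  set R₁ : ℝ := u * (r / δ) * ε ^ (1 - q) / (q - 1) with hR₁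
  set R₂ : ℝ := 4 * u * (r / δ) ^ 2 * ε ^ (2 - q) / η ^ 2 with hR₂
  refine ⟨m * ε ^ (-p) + 2 * Real.exp (R₁ + R₂), fun Ω _ μ X hindep hmeas hlaw S hS => ?_⟩
  have hs1 : (1 : ℝ) ≤ S.card := by exact_mod_cast hS.card_pos
  set s : ℝ := (S.card : ℝ) with hs
  have hs0 : 0 < s := by linarith
  have hlog : 0 ≤ Real.log s := Real.log_nonneg hs1
  refine (sampleMean_deviation_le_of_trunc hindep hmeas hlaw hD (by linarith : 0 < p) hint hq hq2
    hintq hu.ge hS (B := ε * s) (l := r / δ * Real.log s / s) (by positivity)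
    (by positivity)).trans ?_
  rw [add_mul]
  refine add_le_add (le_of_eq ?_) ?_
  · have : s ^ (-r) = s * s ^ (-p) := by
      rw [← Real.rpow_one_add' hs0.le (by linarith)]
      congr 1
      rw [hr]; ring
    rw [Real.mul_rpow hε0.le hs0.le, this]
    ring
  have e1 : r / δ * Real.log s / s * δ * s = r * Real.log s := by field_simp
  have e2 : r / δ * Real.log s / s * (ε * s) = η * Real.log s := by rw [hε]; field_simp
  have e3 : Real.exp (η * Real.log s) = s ^ η := by rw [Real.rpow_def_of_pos hs0, mul_comm]
  have b1 : s * (r / δ * Real.log s / s * u * (ε * s) ^ (1 - q)) ≤ R₁ := by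
    have hl1 := Real.log_le_rpow_div hs0.le (by linarith : 0 < q - 1)
    calc s * (r / δ * Real.log s / s * u * (ε * s) ^ (1 - q))
        = u * (r / δ) * ε ^ (1 - q) * s ^ (1 - q) * Real.log s := by
          rw [Real.mul_rpow hε0.le hs0.le]; field_simp
      _ ≤ u * (r / δ) * ε ^ (1 - q) * s ^ (1 - q) * (s ^ (q - 1) / (q - 1)) := by gcongr
      _ = u * (r / δ) * ε ^ (1 - q) / (q - 1) * (s ^ (1 - q) * s ^ (q - 1)) := by ring
      _ = R₁ := by rw [← Real.rpow_add hs0]; simp [hR₁]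
  have b2 : s * (s ^ η * (r / δ * Real.log s / s) ^ 2 * u * (ε * s) ^ (2 - q)) ≤ R₂ := by
    have hl2 := Real.log_le_rpow_div hs0.le (half_pos hη0)
    have hl3 : Real.log s ^ 2 ≤ (s ^ (η / 2) / (η / 2)) ^ 2 := by gcongr
    have hs2 : (s ^ (η / 2)) ^ 2 = s ^ η := by
      rw [← Real.rpow_natCast, ← Real.rpow_mul hs0.le]; congr 1; push_cast; ring
    have hs3 : s ^ (2 - q) = s * s ^ (1 - q) := by
      rw [show 2 - q = 1 + (1 - q) by ring, Real.rpow_add hs0, Real.rpow_one]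
    have hs4 : (s ^ (η / 2) / (η / 2)) ^ 2 = s ^ η * (4 / η ^ 2) := by
      rw [div_pow, hs2]; field_simp; norm_num
    calc s * (s ^ η * (r / δ * Real.log s / s) ^ 2 * u * (ε * s) ^ (2 - q))
        = u * (r / δ) ^ 2 * ε ^ (2 - q) * (s ^ η * s ^ (1 - q)) * Real.log s ^ 2 := by
          rw [Real.mul_rpow hε0.le hs0.le, hs3]; field_simp
      _ ≤ u * (r / δ) ^ 2 * ε ^ (2 - q) * (s ^ η * s ^ (1 - q)) *
            (s ^ (η / 2) / (η / 2)) ^ 2 := by gcongr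
      _ = R₂ * (s ^ η * s ^ (1 - q) * s ^ η) := by
          rw [hs4, hR₂]; ring
      _ = R₂ := by
          rw [← Real.rpow_add hs0, ← Real.rpow_add hs0]
          have : η + (1 - q) + η = 0 := by rw [hη]; ring
          rw [this, Real.rpow_zero, mul_one]
  have e4 : s ^ (-r) = Real.exp (-(r * Real.log s)) := by
    rw [Real.rpow_def_of_pos hs0]; congr 1; ring
  rw [← hs, e1, e2, e3, e4, mul_assoc 2]
  gcongr 2 * ?_
  rw [← Real.exp_add, mul_add s]
  exact Real.exp_le_exp.2 (by linarith)

/-- Deviation of the truncated sample mean.  With `B = (u / b) ^ (1 / p)`, the truncation level of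
the last observation, and the Chernoff parameter `1 / B`, the exponent is
`b τ (-4 + 2 + 1) = -b τ`: the bias contributes `b Σ (k / τ) ^ (1 / p - 1) ≤ p b τ ≤ 2 b τ` and the
second moments contribute `b τ`. -/
theorem truncMean_deviation_le {N : ℕ} {Ω : Type*} [MeasurableSpace Ω] {F : Fin N → Measure ℝ}
    {μ : Measure Ω} {X : Fin N → ℕ → Ω → ℝ} (hX : IsRewardModel F μ X) (n : Fin N)
    [IsProbabilityMeasure (F n)] (hD : Integrable (fun x : ℝ => x) (F n))
    {p u b δ : ℝ} (hp : 1 < p) (hp2 : p ≤ 2) (hint : Integrable (fun x : ℝ => |x| ^ p) (F n))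
    (hu : ∫ x, |x| ^ p ∂(F n) ≤ u) (hu0 : 0 < u) (hb : 0 < b)
    (hδ : δ = 4 * b * (u / b) ^ (1 / p)) (g : ℕ → ℝ) (t : ℕ)
    (hobs : 0 < obsCount g n (t - 1)) :
    μ.real {ω | δ ≤ |truncMean p u b g (fun n s => X n s ω) n t - mean (F n)|} ≤
      2 * Real.exp (-(b * (obsCount g n (t - 1) : ℝ))) := by
  have hp0 : 0 < p := by linarith
  set S := obsTimes g n (t - 1) with hSdef
  have hS : S.Nonempty := Finset.card_pos.1 hobs
  set τ : ℝ := (obsCount g n (t - 1) : ℝ) with hτ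
  have hτ0 : 0 < τ := Nat.cast_pos.2 hobs
  have hcard : (S.card : ℝ) = τ := rfl
  set β : ℝ := (u / b) ^ (1 / p) with hβ
  have hβ0 : 0 < β := by positivity
  have hβp : u * β ^ (-p) = b := by
    rw [hβ, ← Real.rpow_mul (by positivity), one_div, mul_neg, inv_mul_cancel₀ hp0.ne',
      Real.rpow_neg_one]
    field_simp
  have heps : Real.log (truncEps g b n t)⁻¹ = b * τ := by
    rw [truncEps, Real.log_inv, Real.log_exp, neg_neg]
  set k : ℕ → ℝ := fun s => obsCount g n s with hk
  set B : ℕ → ℝ := fun s => (u * k s / (b * τ)) ^ (1 / p) with hB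
  have hk0 : ∀ s ∈ S, 0 < k s := fun s hs => Nat.cast_pos.2 (obsCount_pos_of_mem hs)
  have hkτ : ∀ s ∈ S, k s ≤ τ := fun s hs =>
    Nat.cast_le.2 (obsCount_mono g n (le_of_mem_obsTimes hs))
  have hBeq : ∀ s ∈ S, B s = β * (k s / τ) ^ (1 / p) := fun s hs => by
    have := hk0 s hs
    rw [hB, hβ, ← Real.mul_rpow (by positivity) (by positivity)]
    simp only
    congr 1
    field_simp
  clear_value β
  have hB0 : ∀ s ∈ S, 0 < B s := fun s hs => by
    have := hk0 s hs
    rw [hBeq s hs]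
    positivity
  have hBβ : ∀ s ∈ S, B s ≤ β := fun s hs => by
    have := hk0 s hs
    rw [hBeq s hs]
    refine mul_le_of_le_one_right hβ0.le (Real.rpow_le_one (by positivity) ?_ (by positivity))
    exact (div_le_one hτ0).2 (hkτ s hs)
  have hmain := measure_abs_average_trunc_sub_ge_le (hX.indep n) (hX.measurable n) (hX.law n) hD hp
    hp2 hint hu hS (B := B) (l := 1 / β) (δ := δ) (c := 1) (κ := 1) (by positivity) hB0 zero_le_one
    (fun s hs => by rw [one_div, inv_mul_le_iff₀ hβ0]; simpa using hBβ s hs)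
    fun x hx => exp_le_of_abs_le_one hx
  have hterm : ∀ s ∈ S, 1 / β * u * B s ^ (1 - p) + 1 * (1 / β) ^ 2 * u * B s ^ (2 - p) ≤
      b * (k s ^ (1 / p - 1) / τ ^ (1 / p - 1)) + b := fun s hs => by
    have hks := hk0 s hs
    refine add_le_add (le_of_eq ?_) ?_
    · rw [hBeq s hs, Real.mul_rpow hβ0.le (by positivity), ← Real.rpow_mul (by positivity),
        ← Real.div_rpow hks.le hτ0.le, ← hβp, Real.rpow_sub hβ0, Real.rpow_one,
        Real.rpow_neg hβ0.le]
      have : 1 / p * (1 - p) = 1 / p - 1 := by field_simp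
      rw [this]
      field_simp
    · calc 1 * (1 / β) ^ 2 * u * B s ^ (2 - p) ≤ 1 * (1 / β) ^ 2 * u * β ^ (2 - p) := by
            have h2 := Real.rpow_le_rpow (hB0 s hs).le (hBβ s hs) (by linarith : 0 ≤ 2 - p)
            gcongr
        _ = u * β ^ (-p) := by
            rw [Real.rpow_sub hβ0, Real.rpow_neg hβ0.le, Real.rpow_two]; field_simp
        _ = b := hβp
  have hsum : ∑ s ∈ S, (1 / β * u * B s ^ (1 - p) + 1 * (1 / β) ^ 2 * u * B s ^ (2 - p)) ≤
      3 * b * τ := by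
    refine (Finset.sum_le_sum hterm).trans ?_
    rw [Finset.sum_add_distrib, ← Finset.mul_sum, ← Finset.sum_div, Finset.sum_const, nsmul_eq_mul,
      hcard, sum_obsTimes_eq g n (fun k => (k : ℝ) ^ (1 / p - 1)) (t - 1)]
    have h1 := sum_Icc_rpow_sub_one_le (e := 1 / p) (by positivity)
      (by rw [div_le_one hp0]; exact hp.le) (obsCount g n (t - 1))
    have h2 : (∑ k ∈ Finset.Icc 1 (obsCount g n (t - 1)), (k : ℝ) ^ (1 / p - 1)) /
        τ ^ (1 / p - 1) ≤ 2 * τ := by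
      rw [div_le_iff₀ (by positivity), Real.rpow_sub_one hτ0.ne']
      refine h1.trans ?_
      rw [← hτ]
      calc τ ^ (1 / p) / (1 / p) = p * τ ^ (1 / p) := by field_simp
        _ ≤ 2 * τ ^ (1 / p) := by gcongr
        _ = _ := by field_simp
    have h3 := mul_le_mul_of_nonneg_left h2 hb.le
    linarith
  have hset : {ω | δ ≤ |truncMean p u b g (fun n s => X n s ω) n t - mean (F n)|} =
      {ω | δ ≤ |(∑ s ∈ S, trunc (B s) (X n s ω)) / (S.card : ℝ) - mean (F n)|} := by
    simp only [truncMean, heps]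
    rfl
  rw [hset]
  refine hmain.trans ?_
  gcongr
  have h4 : 1 / β * δ * S.card = 4 * b * τ := by
    rw [hcard, hδ]; field_simp
  linarith

/-! ### Regret bounds -/

section

variable {N M : ℕ} {Ω : Type*} [MeasurableSpace Ω] {μ : Measure Ω}

/-- The exploration cost is at most the largest cost times the total number of observations. -/
theorem sum_obsCount_mul_setCost_le {C : Fin N → ℝ} (hC : ∀ j : Fin N, M ≤ (j : ℕ) → 0 < C j)
    (σ : Equiv.Perm (Fin N)) {g : ℕ → ℝ} {T : ℕ} {A : ℝ} (hA : ∀ n : Fin N, (obsCount g n T : ℝ) ≤ A) :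
    ∑ j, (obsCount g (σ j) T : ℝ) * setCost M C j ≤ N * maxCost M C * A := by
  calc ∑ j, (obsCount g (σ j) T : ℝ) * setCost M C j ≤ ∑ _j : Fin N, A * maxCost M C := by
        refine Finset.sum_le_sum fun j _ => mul_le_mul (hA _) (setCost_le_maxCost M C j)
          (setCost_nonneg hC j) ((Nat.cast_nonneg _).trans (hA (σ j)))
    _ = _ := by simp; ring

theorem sum_filter_measure_wrong_le {g : ℕ → ℝ} {σ : Equiv.Perm (Fin N)} {play : ℕ → Ω → Fin N}
    {T : ℕ} {β : ℕ → ℝ} (hβ : ∀ t, 1 ≤ t → 0 ≤ β t)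
    (h : ∀ t, 1 ≤ t → t ∉ exploreSet g t → μ.real {ω | M ≤ (σ.symm (play t ω) : ℕ)} ≤ β t) :
    ∑ t ∈ (Finset.Icc 1 T).filter (fun t => t ∉ exploreSet g t),
      μ.real {ω | M ≤ (σ.symm (play t ω) : ℕ)} ≤ ∑ t ∈ Finset.Icc 1 T, β t := by
  refine (Finset.sum_le_sum fun t ht => ?_).trans (Finset.sum_le_sum_of_subset_of_nonneg
    (Finset.filter_subset _ _) fun t ht _ => hβ t (Finset.mem_Icc.1 ht).1)
  rw [Finset.mem_filter, Finset.mem_Icc] at ht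
  exact h t ht.1.1 ht.2

end

theorem exists_pos_forall_le {N : ℕ} (hN : 0 < N) {f : Fin N → ℝ} (hf : ∀ n, 0 < f n) :
    ∃ b : ℝ, 0 < b ∧ ∀ n, b ≤ f n := by
  have hne : (Finset.univ : Finset (Fin N)).Nonempty := ⟨⟨0, hN⟩, Finset.mem_univ _⟩
  exact ⟨Finset.univ.inf' hne f, (Finset.lt_inf'_iff _).2 fun n _ => hf n,
    fun n => Finset.inf'_le _ (Finset.mem_univ n)⟩

/-- Light tails, no knowledge: once `b f(t) ≥ 2`, where `b` is a common exponential rate, wrong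
exploitation at time `t` has probability at most `2 N t ^ (-2)`. -/
theorem exists_regretAtMost_of_lightTailed {N M : ℕ} (hM : 1 ≤ M) (hMN : M < N)
    {F : Fin N → Measure ℝ} (hF : ∀ n, IsProbabilityMeasure (F n))
    (hmean : ∀ n, Integrable (fun x : ℝ => x) (F n))
    {σ : Equiv.Perm (Fin N)} (hσ : SortsArms F σ) (hgap : 0 < gap F σ M hMN)
    {C : Fin N → ℝ} (hC : ∀ j : Fin N, M ≤ (j : ℕ) → 0 < C j)
    (hlight : ∀ n, LightTailed (F n)) {f : ℕ → ℝ} (hf0 : ∀ t, 0 < f t) (hf : Monotone f)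
    (hftop : Tendsto f atTop atTop) {g : ℕ → ℝ}
    (hg : ∀ t, g t = (N : ℝ) * (⌈f t * Real.log t⌉₊ : ℝ)) :
    ∃ K : ℝ, RegretAtMost.{u} F σ M C g (sampleMean g) 2 fun T => K * (f T * Real.log T) := by
  set δ : ℝ := gap F σ M hMN / 2 with hδ
  have hδ0 : 0 < δ := by positivity
  choose l hl0 hint hint' hmgf hmgf' using fun n =>
    exists_mgf_centered_le (hmean n) (hlight n) hδ0
  obtain ⟨b, hb0, hb⟩ := exists_pos_forall_le (by omega : 0 < N)
    (f := fun n => l n * δ / 2) fun n => by have := hl0 n; positivity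
  obtain ⟨t₀, ht₀⟩ := eventually_atTop.1 (hftop.eventually_ge_atTop (2 / b))
  have hmono : Monotone fun t : ℕ => f t * Real.log t := fun s t hst =>
    mul_le_mul (hf hst) (monotone_log_natCast hst) (Real.log_natCast_nonneg s) (hf0 t).le
  have hL2 : 0 < f 2 * Real.log (2 : ℕ) :=
    mul_pos (hf0 2) (Real.log_pos (by norm_num))
  set Q : ℝ := N * maxCost M C with hQ
  have hmax : 0 ≤ maxCost M C := maxCost_nonneg hC
  have hQ0 : 0 ≤ Q := by positivity
  set R : ℝ := maxCost M C * (t₀ + 1 + 2 * N * 2) with hR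
  have hR0 : 0 ≤ R := by positivity
  refine ⟨Q + (Q + R) / (f 2 * Real.log (2 : ℕ)), ?_⟩
  intro Ω _ μ _ X play hX hplay T hT
  have hlogT : f 2 * Real.log (2 : ℕ) ≤ f T * Real.log T := hmono hT
  have hexplore := sum_obsCount_mul_setCost_le hC σ (g := g) (T := T)
    (A := f T * Real.log T + 1) fun n => (Nat.cast_le.2 (obsCount_le_ceil hmono hg T n)).trans
      (Nat.ceil_lt_add_one (hL2.le.trans hlogT)).le
  have hbad : ∀ t, 1 ≤ t → t ∉ exploreSet g t → μ.real {ω | M ≤ (σ.symm (play t ω) : ℕ)} ≤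
      (if t ≤ t₀ + 1 then 1 else 0) + 2 * N * (t : ℝ) ^ (-2 : ℝ) := by
    intro t ht hte
    have hpow : (0 : ℝ) ≤ 2 * N * (t : ℝ) ^ (-2 : ℝ) := by positivity
    split_ifs with htt
    · exact measureReal_le_one.trans (by linarith)
    have ht0 : (0 : ℝ) < t := by exact_mod_cast (by omega : 0 < t)
    have hlog : 0 < Real.log t := Real.log_pos (by exact_mod_cast (by omega : 1 < t))
    have hobs : ∀ n : Fin N, ⌈f t * Real.log t⌉₊ ≤ obsCount g n (t - 1) :=
      ceil_le_obsCount hg (by omega) hte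
    have hpos : ∀ n : Fin N, 0 < obsCount g n (t - 1) := fun n =>
      (Nat.ceil_pos.2 (mul_pos (hf0 t) hlog)).trans_le (hobs n)
    refine (measure_wrong_le hM hMN hσ (δ := δ) (by rw [hδ]; linarith) hplay ht hte hpos).trans ?_
    calc _ ≤ ∑ n : Fin N, 2 * (t : ℝ) ^ (-2 : ℝ) := by
          refine Finset.sum_le_sum fun n _ => ?_
          refine (sampleMean_deviation_le (hX.indep n) (hX.measurable n) (hX.law n)
            (Finset.card_pos.1 (hpos n)) (hl0 n).le (hint n) (hint' n) (hmgf n) (hmgf' n)).trans ?_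
          rw [Real.rpow_def_of_pos ht0]
          have h1 : f t * Real.log t ≤ obsCount g n (t - 1) := Nat.ceil_le.1 (hobs n)
          have h2 : 2 ≤ b * f t := by
            have := ht₀ t (by omega)
            rwa [div_le_iff₀ hb0, mul_comm] at this
          have h3 : Real.log t * 2 ≤ (l n * δ - l n * δ / 2) * obsCount g n (t - 1) :=
            calc Real.log t * 2 ≤ Real.log t * (b * f t) := by gcongr
              _ = b * (f t * Real.log t) := by ring
              _ ≤ l n * δ / 2 * obsCount g n (t - 1) := by
                  have hbn := hb n
                  have h5 := (mul_pos (hf0 t) hlog).le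
                  exact mul_le_mul hbn h1 h5 (hb0.le.trans hbn)
              _ = _ := by ring
          have h4 : -((l n * δ - l n * δ / 2) * ((obsTimes g n (t - 1)).card : ℝ)) ≤
              Real.log t * -2 := by
            change Real.log t * 2 ≤ _ * ((obsTimes g n (t - 1)).card : ℝ) at h3
            linarith
          gcongr
      _ = 0 + 2 * N * (t : ℝ) ^ (-2 : ℝ) := by simp; ring
  have hsum := sum_filter_measure_wrong_le (T := T) (fun t _ => by positivity) hbad
  rw [Finset.sum_add_distrib, ← Finset.mul_sum] at hsum
  have hsum1 : ∑ t ∈ Finset.Icc 1 T, (if t ≤ t₀ + 1 then (1 : ℝ) else 0) ≤ t₀ + 1 := by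
    rw [Finset.sum_boole]
    have : ((Finset.Icc 1 T).filter fun t => t ≤ t₀ + 1).card ≤ (Finset.Icc 1 (t₀ + 1)).card :=
      Finset.card_le_card fun t ht => by
        simp only [Finset.mem_filter, Finset.mem_Icc] at ht ⊢
        omega
    rw [Nat.card_Icc] at this
    exact_mod_cast this
  have hsum2 : ∑ t ∈ Finset.Icc 1 T, (t : ℝ) ^ (-2 : ℝ) ≤ 2 := by
    rw [← Finset.add_sum_Ioc_eq_sum_Icc (by omega : 1 ≤ T)]
    have := sum_Icc_two_rpow_neg_le one_lt_two T
    have hset : Finset.Ioc 1 T = Finset.Icc 2 T := rfl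
    rw [hset]
    norm_num at this ⊢
    linarith
  have hexploit : maxCost M C * ∑ t ∈ (Finset.Icc 1 T).filter (fun t => t ∉ exploreSet g t),
      μ.real {ω | M ≤ (σ.symm (play t ω) : ℕ)} ≤ R := by
    rw [hR]
    refine mul_le_mul_of_nonneg_left (hsum.trans ?_) hmax
    gcongr
  have hK : Q + R ≤ (Q + R) / (f 2 * Real.log (2 : ℕ)) * (f T * Real.log T) := by
    rw [div_mul_eq_mul_div, le_div_iff₀ hL2]
    gcongr
  calc regret σ M C μ play T ≤ Q * (f T * Real.log T + 1) + R :=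
        (regret_le hplay σ T).trans (add_le_add hexplore hexploit)
    _ ≤ (Q + (Q + R) / (f 2 * Real.log (2 : ℕ))) * (f T * Real.log T) := by
        rw [add_mul]; linarith

/-- Finite `p`-th moments: with threshold `v t ^ e`, `1 / p ≤ e ≤ 1`, each arm has at least
`v t ^ e / (2 N)` observations, so a deviation bound of order `s ^ (1 - p) ≤ s ^ (1 - 1 / e)` makes
wrong exploitation at time `t` have probability `O(t ^ (e - 1))`, which sums to `O(T ^ e)`. -/
theorem exists_regretAtMost_of_moment {N M : ℕ} (hM : 1 ≤ M) (hMN : M < N)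
    {F : Fin N → Measure ℝ} (hF : ∀ n, IsProbabilityMeasure (F n))
    (hmean : ∀ n, Integrable (fun x : ℝ => x) (F n))
    {σ : Equiv.Perm (Fin N)} (hσ : SortsArms F σ) (hgap : 0 < gap F σ M hMN)
    {C : Fin N → ℝ} (hC : ∀ j : Fin N, M ≤ (j : ℕ) → 0 < C j) {p v e : ℝ} (hp : 1 < p)
    (hv : 0 < v) (hmom : ∀ n, Integrable (fun x : ℝ => |x| ^ p) (F n)) (he0 : 0 < e) (he1 : e ≤ 1)
    (hep : 1 / e ≤ p) {g : ℕ → ℝ} (hg : ∀ t : ℕ, g t = v * (t : ℝ) ^ e) :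
    ∃ K : ℝ, RegretAtMost.{u} F σ M C g (sampleMean g) 1 fun T => K * (T : ℝ) ^ e := by
  set δ : ℝ := gap F σ M hMN / 2 with hδ
  have hδ0 : 0 < δ := by positivity
  have hN : (0 : ℝ) < N := by exact_mod_cast (by omega : 0 < N)
  choose K hK using fun n =>
    exists_polynomial_deviation_bound.{u} (hmean n) hp (hmom n) hδ0
  have hmax : 0 ≤ maxCost M C := maxCost_nonneg hC
  set r : ℝ := 1 / e - 1 with hr
  have hr0 : 0 ≤ r := by
    have : 1 ≤ 1 / e := by rw [le_div_iff₀ he0]; linarith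
    linarith
  have her : e * -r = e - 1 := by rw [hr]; field_simp; ring
  set A : ℝ := (v / (2 * N)) ^ (-r) with hA
  have hA0 : 0 ≤ A := by positivity
  set Q : ℝ := (1 + ∑ n, |K n|) * A + 1 with hQ
  have hQ0 : 0 ≤ Q := by positivity
  have hmono : Monotone g := fun s t hst => by
    rw [hg, hg]
    gcongr
  have hg0 : ∀ t, 0 ≤ g t := fun t => by rw [hg]; positivity
  refine ⟨N * maxCost M C * (v + 1) + maxCost M C * (Q / e), ?_⟩
  intro Ω _ μ _ X play hX hplay T hT
  have hTe : 1 ≤ (T : ℝ) ^ e := Real.one_le_rpow (by exact_mod_cast hT) he0.le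
  have hexplore := sum_obsCount_mul_setCost_le hC σ (g := g) (T := T)
    (A := (v + 1) * (T : ℝ) ^ e) fun n => by
      have h1 : obsCount g n T ≤ (exploreSet g T).card :=
        Finset.card_le_card (Finset.filter_subset _ _)
      have h2 := card_exploreSet_le hmono hg0 T
      have h3 : (obsCount g n T : ℝ) ≤ ((exploreSet g T).card : ℝ) := Nat.cast_le.2 h1
      rw [hg] at h2
      linarith
  have hbad : ∀ t, 1 ≤ t → t ∉ exploreSet g t → μ.real {ω | M ≤ (σ.symm (play t ω) : ℕ)} ≤
      Q * (t : ℝ) ^ (e - 1) := by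
    intro t ht hte
    rcases ht.eq_or_lt with rfl | ht1
    · rw [Nat.cast_one, Real.one_rpow, mul_one]
      refine measureReal_le_one.trans ?_
      rw [hQ]
      have : 0 ≤ (1 + ∑ n, |K n|) * A := by positivity
      linarith
    have ht0 : (0 : ℝ) < t := by exact_mod_cast ht
    have hcard := le_card_exploreSet ht1 hte
    rw [hg] at hcard
    have hAt : (v / (2 * N) * (t : ℝ) ^ e) ^ (-r) = A * (t : ℝ) ^ (e - 1) := by
      rw [Real.mul_rpow (by positivity) (by positivity), ← Real.rpow_mul ht0.le, her]
    have hobs : ∀ n : Fin N, v * (t : ℝ) ^ e ≤ N * (obsCount g n (t - 1) + 1) := fun n =>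
      hcard.trans (by exact_mod_cast card_exploreSet_le_mul_obsCount g (t - 1) n)
    have hx0 : 0 < v / (2 * N) * (t : ℝ) ^ e := by positivity
    have hmain : μ.real {ω | M ≤ (σ.symm (play t ω) : ℕ)} ≤
        (1 + ∑ n, |K n|) * (v / (2 * N) * (t : ℝ) ^ e) ^ (-r) := by
      have hxr : 0 ≤ (v / (2 * N) * (t : ℝ) ^ e) ^ (-r) := by positivity
      by_cases hpos : ∀ n : Fin N, 0 < obsCount g n (t - 1)
      · refine (measure_wrong_le hM hMN hσ (δ := δ) (by rw [hδ]; linarith) hplay ht hte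
          hpos).trans ?_
        have hsum : ∑ n, μ.real {ω | δ ≤ |sampleMean g (fun n s => X n s ω) n t - mean (F n)|} ≤
            ∑ n, |K n| * (v / (2 * N) * (t : ℝ) ^ e) ^ (-r) := by
          refine Finset.sum_le_sum fun n _ => ?_
          refine (hK n Ω μ (X n) (hX.indep n) (hX.measurable n) (hX.law n) _
            (Finset.card_pos.1 (hpos n))).trans ?_
          have hc1 : (1 : ℝ) ≤ ((obsTimes g n (t - 1)).card : ℝ) := by exact_mod_cast hpos n
          have hc2 : v / (2 * N) * (t : ℝ) ^ e ≤ ((obsTimes g n (t - 1)).card : ℝ) := by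
            have h1 : v * (t : ℝ) ^ e ≤ N * (((obsTimes g n (t - 1)).card : ℝ) + 1) := hobs n
            rw [div_mul_eq_mul_div, div_le_iff₀ (by positivity)]
            nlinarith
          refine mul_le_mul (le_abs_self _) ?_ (by positivity) (abs_nonneg _)
          calc ((obsTimes g n (t - 1)).card : ℝ) ^ (-(p - 1))
              ≤ ((obsTimes g n (t - 1)).card : ℝ) ^ (-r) :=
                Real.rpow_le_rpow_of_exponent_le hc1 (by rw [hr]; linarith)
            _ ≤ _ := Real.rpow_le_rpow_of_nonpos hx0 hc2 (by linarith)
        rw [← Finset.sum_mul] at hsum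
        rw [add_mul]
        linarith
      · push Not at hpos
        obtain ⟨n, hn⟩ := hpos
        have hn0 : obsCount g n (t - 1) = 0 := by omega
        -- fewer than `N` explorations so far: this bounds `t`, so the claimed bound exceeds `1`
        have h1 := hobs n
        rw [hn0, Nat.cast_zero, zero_add, mul_one] at h1
        have h2 : v / (2 * N) * (t : ℝ) ^ e ≤ 1 := by
          rw [div_mul_eq_mul_div, div_le_one (by positivity)]
          linarith
        have h3 := Real.one_le_rpow_of_pos_of_le_one_of_nonpos hx0 h2 (by linarith : -r ≤ 0)
        refine measureReal_le_one.trans (h3.trans (le_mul_of_one_le_left hxr ?_))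
        have : 0 ≤ ∑ n, |K n| := by positivity
        linarith
    rw [hAt, ← mul_assoc] at hmain
    refine hmain.trans ?_
    gcongr
    rw [hQ]
    linarith
  have hsum := sum_filter_measure_wrong_le (T := T) (fun t _ => by positivity) hbad
  rw [← Finset.mul_sum] at hsum
  have hexploit : maxCost M C * ∑ t ∈ (Finset.Icc 1 T).filter (fun t => t ∉ exploreSet g t),
      μ.real {ω | M ≤ (σ.symm (play t ω) : ℕ)} ≤ maxCost M C * (Q * ((T : ℝ) ^ e / e)) := by
    refine mul_le_mul_of_nonneg_left (hsum.trans ?_) hmax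
    gcongr
    exact sum_Icc_rpow_sub_one_le he0 he1 T
  calc regret σ M C μ play T
      ≤ N * maxCost M C * ((v + 1) * (T : ℝ) ^ e) + maxCost M C * (Q * ((T : ℝ) ^ e / e)) :=
        (regret_le hplay σ T).trans (add_le_add hexplore hexploit)
    _ = _ := by ring

/-- The constant `4 ^ (p / (1 - p)) * u ^ (1 / (1 - p))` is the one for which the truncated mean has
deviation `δ` at rate `b = a δ ^ (p / (p - 1))`. -/
theorem four_mul_rate_mul_level {p u a δ : ℝ} (hp : 1 < p) (hu : 0 < u) (hδ : 0 < δ)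
    (ha : a = (4 : ℝ) ^ (p / (1 - p)) * u ^ (1 / (1 - p))) :
    δ = 4 * (a * δ ^ (p / (p - 1))) * (u / (a * δ ^ (p / (p - 1)))) ^ (1 / p) := by
  have ha0 : 0 < a := by rw [ha]; positivity
  have hp0 : p ≠ 0 := by positivity
  have hp1 : p - 1 ≠ 0 := by linarith
  have hp1' : 1 - p ≠ 0 := by linarith
  set b : ℝ := a * δ ^ (p / (p - 1)) with hb
  have hb0 : 0 < b := by positivity
  have h1 : b ^ (1 - 1 / p) = 4⁻¹ * (u ^ (1 / p))⁻¹ * δ := by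
    rw [hb, ha, Real.mul_rpow (by positivity) (by positivity),
      Real.mul_rpow (by positivity) (by positivity), ← Real.rpow_mul hδ.le, ← Real.rpow_mul hu.le,
      ← Real.rpow_mul (by norm_num), ← Real.rpow_neg hu.le]
    have e1 : p / (p - 1) * (1 - 1 / p) = 1 := by field_simp
    have e2 : p / (1 - p) * (1 - 1 / p) = -1 := by field_simp; ring
    have e3 : 1 / (1 - p) * (1 - 1 / p) = -(1 / p) := by field_simp; ring
    rw [e1, e2, e3, Real.rpow_one, Real.rpow_neg_one]
  have hu1 : 0 < u ^ (1 / p) := by positivity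
  calc δ = 4 * u ^ (1 / p) * b ^ (1 - 1 / p) := by rw [h1]; field_simp
    _ = _ := by
      rw [Real.div_rpow hu.le hb0.le, Real.rpow_sub hb0, Real.rpow_one]; ring

end

end DSEE

theorem theorem6 (N M : ℕ) (hM : 1 ≤ M) (hMN : M < N)
    (F : Fin N → Measure ℝ) (hF : ∀ n, IsProbabilityMeasure (F n))
    (hmean : ∀ n, Integrable (fun x : ℝ => x) (F n))
    (σ : Equiv.Perm (Fin N)) (hσ : DSEE.SortsArms F σ)
    (hgap : 0 < DSEE.gap F σ M hMN)
    (C : Fin N → ℝ) (hC : ∀ j : Fin N, M ≤ (j : ℕ) → 0 < C j) :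
    -- light tails, with knowledge of a lower bound `c` of the gap and of `a`, `ζ`, `u₀`
    (∀ a ζ u₀ : ℝ, 0 < a → 0 < ζ → 0 < u₀ →
      (((∀ n, DSEE.LightTailedWith (F n) ζ u₀) ∧ a ≤ 1 / (2 * ζ)) ∨
        ∀ n, DSEE.ChernoffHolds (F n) a ζ u₀) →
      ∀ c δ w : ℝ, 0 < c → c < DSEE.gap F σ M hMN → δ = min (c / 2) (ζ * u₀) →
      1 / (a * δ ^ 2) < w →
      ∀ g : ℕ → ℝ, (∀ t, g t = (N : ℝ) * (⌈w * Real.log t⌉₊ : ℝ)) →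
      DSEE.RegretAtMost.{u} F σ M C g (DSEE.sampleMean g) 0 fun T =>
        ∑ j : Fin N, (⌈w * Real.log T⌉₊ : ℝ) * DSEE.setCost M C j
          + 2 * (N : ℝ) * DSEE.maxCost M C * (1 + 1 / (a * δ ^ 2 * w - 1))) ∧
    -- light tails, without any knowledge
    ((∀ n, DSEE.LightTailed (F n)) →
      ∀ f : ℕ → ℝ, (∀ t, 0 < f t) → Monotone f → Tendsto f atTop atTop →
      ∀ g : ℕ → ℝ, (∀ t, g t = (N : ℝ) * (⌈f t * Real.log t⌉₊ : ℝ)) →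
      ∃ K : ℝ, DSEE.RegretAtMost.{u} F σ M C g (DSEE.sampleMean g) 2 fun T =>
        K * (f T * Real.log T)) ∧
    -- finite moments of order `p`
    (∀ p v : ℝ, 1 < p → 0 < v → (∀ n, Integrable (fun x : ℝ => |x| ^ p) (F n)) →
      ∀ e : ℝ, e = (if p ≤ 2 then 1 / p else 1 / (1 + p / 2)) →
      ∀ g : ℕ → ℝ, (∀ t : ℕ, g t = v * (t : ℝ) ^ e) →
      ∃ K : ℝ, DSEE.RegretAtMost.{u} F σ M C g (DSEE.sampleMean g) 1 fun T =>
        K * (T : ℝ) ^ e) ∧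
    -- a known bound on the moments of order `p ≤ 2`, with truncated sample means
    (∀ p b a δ w : ℝ, 1 < p → p ≤ 2 → 0 < b →
      (∀ n, Integrable (fun x : ℝ => |x| ^ p) (F n) ∧ ∫ x, |x| ^ p ∂(F n) ≤ b) →
      a = (4 : ℝ) ^ (p / (1 - p)) * b ^ (1 / (1 - p)) →
      0 < δ → δ < DSEE.gap F σ M hMN / 2 →
      1 / (a * δ ^ (p / (p - 1))) < w →
      ∀ g : ℕ → ℝ, (∀ t, g t = (N : ℝ) * (⌈w * Real.log t⌉₊ : ℝ)) →
      DSEE.RegretAtMost.{u} F σ M C g (DSEE.truncMean p b (a * δ ^ (p / (p - 1))) g) 0 fun T =>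
        ∑ j : Fin N, (⌈w * Real.log T⌉₊ : ℝ) * DSEE.setCost M C j
          + 2 * (N : ℝ) * DSEE.maxCost M C * (1 + 1 / (a * δ ^ (p / (p - 1)) * w - 1))) := by
  refine ⟨?_, ?_, ?_, ?_⟩
  · intro a ζ u₀ ha hζ hu₀ htail c δ w hc hcgap hδ hw g hg Ω _ μ _ X play hX hplay T _
    have hδ0 : 0 < δ := by rw [hδ]; positivity
    have hδc : δ ≤ c / 2 := hδ.trans_le (min_le_left _ _)
    have hδu : δ ≤ ζ * u₀ := hδ.trans_le (min_le_right _ _)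
    refine DSEE.regret_le_of_exp_deviation hM hMN hσ (δ := δ) (by linarith) hC
      (by positivity) hw hg hplay (fun n t hobs => ?_) T
    rcases htail with ⟨hlight, haζ⟩ | hchernoff
    · refine (DSEE.sampleMean_deviation_le_of_lightTailedWith (hmean n) (hX.indep n)
        (hX.measurable n) (hX.law n) (Finset.card_pos.1 hobs) hζ hδ0 hδu (hlight n)).trans ?_
      rw [DSEE.obsCount]
      gcongr
    · exact DSEE.sampleMean_deviation_le_of_chernoffHolds (hX.indep n) (hX.measurable n)
        (hX.law n) (Finset.card_pos.1 hobs) hδ0.le hδu (hchernoff n)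
  · intro hlight f hf0 hf hftop g hg
    exact DSEE.exists_regretAtMost_of_lightTailed hM hMN hF hmean hσ hgap hC hlight hf0 hf hftop hg
  · intro p v hp hv hmom e he g hg
    have hp0 : 0 < p := by linarith
    -- in both regimes `1 / p ≤ e ≤ 1`: `e = 1 / p`, or `1 / e = 1 + p / 2 ≤ p`
    have hepos : 0 < e ∧ e ≤ 1 ∧ 1 / e ≤ p := by
      rw [he]
      split_ifs with hp2
      · exact ⟨by positivity, (div_le_one hp0).2 hp.le, by rw [one_div_one_div]⟩
      · exact ⟨by positivity, (div_le_one (by positivity)).2 (by linarith),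
          by rw [one_div_one_div]; linarith⟩
    exact DSEE.exists_regretAtMost_of_moment hM hMN hF hmean hσ hgap hC hp hv hmom hepos.1
      hepos.2.1 hepos.2.2 hg
  · intro p b a δ w hp hp2 hb hmom ha hδ0 hδ hw g hg Ω _ μ _ X play hX hplay T _
    have ha0 : 0 < a := by rw [ha]; positivity
    exact DSEE.regret_le_of_exp_deviation hM hMN hσ (δ := δ) (by linarith) hC
      (by positivity) hw hg hplay (fun n t hobs => DSEE.truncMean_deviation_le hX n (hmean n) hp hp2
        (hmom n).1 (hmom n).2 hb (by positivity)
        (DSEE.four_mul_rate_mul_level hp hb hδ0 ha) g t hobs) T
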